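/- Let $d\ge 2$ be an integer, let $\mathbb{Q}$ be a probability measure on $\mathbb{R}_+=[0,\infty)$, and let $Y$ be a random variable with distribution $\mathbb{Q}$. Write $e_d=(0,\dots,0,1)$ and $B(x,a)$ for the closed Euclidean ball in $\mathbb{R}^d$ with centre $x$ and radius $a\ge 0$ (so $B(x,0)=\{x\}$), and let $D^o$ and $\partial D$ denote the interior and the boundary of a set $D$. Say that $x$ is lower than $y$ if $\langle x,e_d\rangle<\langle y,e_d\rangle$, and that $x$ is a local minimum of $D\subset\mathbb{R}^d$ if $x\in D$ and $x$ is lower than every other point of $D\cap U$ for some neighbourhood $U$ of $x$. For a set $\psi=\{(x_1,a_1),\dots,(x_d,a_d)\}$ of $d$ distinct elements of $\mathbb{R}^d\times\mathbb{R}_+$, let $h^{(1)}(\psi)=1$ if $\bigcap_{i=1}^d\partial B(x_i,a_i)$ consists of exactly two points $p,q$, named so that $p$ is lower than $q$ (or, if they have the same height, so that $p$ precedes $q$ lexicographically), and $q$ is a local minimum of $\mathbb{R}^d\setminus\bigcup_{i=1}^d B(x_i,a_i)^o$. In all other cases let $h^{(1)}(\psi)=0$. With $o$ the origin and $\lambda_d$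 Lebesgue measure on $\mathbb{R}^d$, define for $a_1,\dots,a_d\in\mathbb{R}_+$ $$G(a_1,\dots,a_d)=\frac1{d!}\int_{(\mathbb{R}^d)^{d-1}}h^{(1)}(\{(o,a_1),(x_2,a_2),\dots,(x_d,a_d)\})\,\lambda_d^{d-1}(d(x_2,\dots,x_d)),$$ $$c_0=\int_{\mathbb{R}_+^d}G(a_1,\dots,a_d)\prod_{i=1}^d\mathbb{Q}(da_i).$$ Let $\theta_d=\lambda_d(B(o,1))$. Then the following hold. 1. For all $s_1,\dots,s_d\in\mathbb{R}_+$ the integrand defining $G(s_1,\dots,s_d)$ is integrable, and $$G(s_1,\dots,s_d)=\frac{\pi^{(d^2-1)/2}}{d!\,\Gamma((1+d)/2)^{d-1}}\prod_{i=1}^d s_i^{d-1}.$$ 2. If $\mathbb{E}[Y^{d-1}]<\infty$, then $G$ is integrable with respect to $\mathbb{Q}^{\otimes d}$, and $$c_0=\frac{(\mathbb{E}[Y^{d-1}])^d\,\theta_d^{d-1}}{d!}\Big(\frac{\sqrt\pi\,\Gamma(1+d/2)}{\Gamma((1+d)/2)}\Big)^{d-1}=\frac{(\mathbb{E}[Y^{d-1}])^d\,\pi^{(d^2-1)/2}}{d!\,\Gamma((1+d)/2)^{d-1}}.$$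 3. If $0<\mathbb{E}[Y^d]<\infty$ and $\alpha=\theta_d\,\mathbb{E}[Y^d]$, then $c_0$ agrees with the Hall–Janson constant: for every integer $k\ge1$, $$\frac{c_0\,\alpha^{1-d}}{(k-1)!}=c_{d,k,Y}:=\frac1{d!\,(k-1)!}\Big(\frac{\sqrt\pi\,\Gamma(1+d/2)}{\Gamma((d+1)/2)}\Big)^{d-1}\frac{(\mathbb{E}[Y^{d-1}])^d}{(\mathbb{E}[Y^d])^{d-1}}.$$ -/

import Mathlib

open MeasureTheory ProbabilityTheory
open scoped NNReal Nat

noncomputable section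

namespace BooleanCoverage

/-- Euclidean `d`-space `ℝ^d`. -/
abbrev E (d : ℕ) : Type := EuclideanSpace ℝ (Fin d)

/-- The height `⟨x, e_d⟩` of a point, i.e. its last coordinate. -/
def height {d : ℕ} [NeZero d] (x : E d) : ℝ :=
  x ⟨d - 1, Nat.sub_one_lt (NeZero.ne d)⟩

/-- `x` is lower than `y`. -/
def Lower {d : ℕ} [NeZero d] (x y : E d) : Prop := height x < height y

/-- `p` is lower than `q`, or they have equal height and `p` precedes `q` lexicographically. -/
def Before {d : ℕ} [NeZero d] (p q : E d) : Prop :=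
  Lower p q ∨ (height p = height q ∧ toLex (WithLp.ofLp p) < toLex (WithLp.ofLp q))

/-- `x` is a local minimum of the set `D`: it lies in `D` and is (strictly) lower than every other
point of `D` in some neighbourhood of `x`. -/
def IsLocalMinimum {d : ℕ} [NeZero d] (D : Set (E d)) (x : E d) : Prop :=
  x ∈ D ∧ ∃ U ∈ nhds x, ∀ y ∈ D ∩ U, y ≠ x → Lower x y

/-- The intersection of the boundaries of the balls `B(x, r a)`, `(x, a) ∈ ψ`. -/
def spheresInter {d : ℕ} (r : ℝ) (ψ : Set (E d × ℝ≥0)) : Set (E d) :=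
  ⋂ z ∈ ψ, frontier (Metric.closedBall z.1 (r * z.2))

/-- The complement of the union of the interiors of the balls `B(x, r a)`, `(x, a) ∈ ψ`. -/
def openBallsCompl {d : ℕ} (r : ℝ) (ψ : Set (E d × ℝ≥0)) : Set (E d) :=
  (⋃ z ∈ ψ, interior (Metric.closedBall z.1 (r * z.2)))ᶜ

open Classical in
/-- The indicator `h^{(r)}(ψ)` that `ψ` consists of `d` marked points, that the intersection of the
`d` spheres consists of exactly two points `p`, `q` (named so that `p` comes before `q`), and that
`q` is a local minimum of the complement of the open balls. -/
def h {d : ℕ} [NeZero d] (r : ℝ) (ψ : Set (E d × ℝ≥0)) : ℝ :=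
  if ψ.encard = d ∧ (spheresInter r ψ).encard = 2 ∧
      ∃ p ∈ spheresInter r ψ, ∃ q ∈ spheresInter r ψ,
        Before p q ∧ IsLocalMinimum (openBallsCompl r ψ) q
  then 1 else 0

/-- The marked point set `{(o, a₁), (x₂, a₂), …, (x_d, a_d)}`. The indices `1, …, d` are the
elements of `Fin d`, and `0 : Fin d` is the first of them. -/
def config {d : ℕ} [NeZero d] (a : Fin d → ℝ≥0) (x : {i : Fin d // i ≠ 0} → E d) :
    Set (E d × ℝ≥0) :=
  insert (0, a 0) (Set.range fun i : {i : Fin d // i ≠ 0} => (x i, a i))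

/-- `G(a₁, …, a_d)`: `1 / d!` times the integral of `h^{(1)}` over `(x₂, …, x_d)`, with respect to
Lebesgue measure on `(ℝ^d)^{d-1}`. -/
def G {d : ℕ} [NeZero d] (a : Fin d → ℝ≥0) : ℝ :=
  1 / (d ! : ℝ) * ∫ x : {i : Fin d // i ≠ 0} → E d, h 1 (config a x)

/-- The constant `c₀`, the integral of `G` with respect to the `d`-fold product of `Q`. -/
def c₀ (d : ℕ) [NeZero d] (Q : Measure ℝ≥0) : ℝ :=
  ∫ a : Fin d → ℝ≥0, G a ∂(Measure.pi fun _ => Q)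

/-- The moment `𝔼[Y ^ m]`. -/
def moment {Ω : Type*} [MeasurableSpace Ω] (P : Measure Ω) (Y : Ω → ℝ≥0) (m : ℕ) : ℝ :=
  ∫ ω, (Y ω : ℝ) ^ m ∂P

/-- `θ_d`, the volume of the unit ball of `ℝ^d`. -/
def θ (d : ℕ) : ℝ := (volume (Metric.closedBall (0 : E d) 1)).toReal

/-- `α = θ_d 𝔼[Y ^ d]`, the expected volume of a ball of radius `Y`. -/
def α {Ω : Type*} [MeasurableSpace Ω] (d : ℕ) (P : Measure Ω) (Y : Ω → ℝ≥0) : ℝ :=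
  θ d * moment P Y d

/-- The Hall–Janson constant `c_{d,k,Y}`. -/
def hallJanson {Ω : Type*} [MeasurableSpace Ω] (d k : ℕ) (P : Measure Ω) (Y : Ω → ℝ≥0) : ℝ :=
  1 / ((d ! : ℝ) * ((k - 1)! : ℝ)) *
    (√Real.pi * Real.Gamma (1 + d / 2) / Real.Gamma ((d + 1) / 2)) ^ (d - 1) *
    (moment P Y (d - 1) ^ d / moment P Y d ^ (d - 1))

end BooleanCoverage

end

namespace BooleanCoverage


/-! For positive radii, put the candidate minimum `q` at the origin and let `y i` be the centres
seen from `q`, so that `‖y i‖ = s i`. Near `q` the uncovered region is cut out by `2⟪v, y i⟫ ≤ ‖v‖ ^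
2`. To first order this is the polar cone of the `y i`, so `q` is a local minimum exactly when
`-e_d` lies in the interior of the simplicial cone they span (`downCone`). The other conditions in
`h` then follow, and `h` is the indicator of `goodConfigs s` (`h_config_of_pos`).

The volume of `goodConfigs s` is found without integrating over spheres. On the open set `downCone`,
`sphereMap s` records the norms of the `y i` together with the differences of their projections to
the spheres of radii `s i`. It is injective, its image is an orthant times `goodConfigs s`, and its
Jacobian is `∏ s i ^ (d - 1) * ‖y i‖ ^ (-d)` times the determinant of the `y i`. A Gaussian weight
in the norms then expresses the volume through the Gaussian integral of `|det|` over `downCone`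
(`volume_goodConfigs_mul`).

Almost every `y` enters `downCone` for exactly one choice of signs of its rows, so this integral is
`2 ^ (-d)` times the one over all matrices (`detMoment_eq_downCone`). The latter is computed row by
row using rotation invariance (`detMoment_eq`). The formulas for `G`, `c₀` and the Hall–Janson
constant follow by product integration and algebra. -/

/-! ### Gaussian and radial integrals. -/

theorem lintegral_prod_eq_pow {X : Type*} [MeasureSpace X] [SigmaFinite (volume : Measure X)]
    {f : X → ℝ} (hf : Integrable f) (h0 : ∀ x, 0 ≤ f x) (n : ℕ) :
    ∫⁻ x : Fin n → X, ENNReal.ofReal (∏ i, f (x i)) = ENNReal.ofReal ((∫ x, f x) ^ n) := by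
  rw [← ofReal_integral_eq_lintegral_ofReal]
  · rw [integral_fintype_prod_volume_eq_pow, Fintype.card_fin]
  · exact Integrable.fintype_prod (f := fun _ => f) (fun _ => hf)
  · exact Filter.Eventually.of_forall fun x => Finset.prod_nonneg fun i _ => h0 _

/-- The unnormalised Gaussian density `exp (-‖v‖² / 2)`. -/
noncomputable def gauss {V : Type*} [Norm V] (v : V) : ℝ := Real.exp (-(‖v‖ ^ 2 / 2))

theorem gauss_pos {V : Type*} [Norm V] (v : V) : 0 < gauss v := Real.exp_pos _

theorem continuous_gauss {V : Type*} [SeminormedAddCommGroup V] :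
    Continuous (gauss : V → ℝ) := by
  unfold gauss; fun_prop

theorem integrable_gauss_real : Integrable (gauss : ℝ → ℝ) := by
  refine (integrable_exp_neg_mul_sq (b := 1 / 2) (by norm_num)).congr
    (Filter.Eventually.of_forall fun x => ?_)
  simp only [gauss, Real.norm_eq_abs, sq_abs]
  congr 1; ring

theorem integral_gauss_real : ∫ x : ℝ, gauss x = √(2 * Real.pi) := by
  have := integral_gaussian (1 / 2)
  rw [show Real.pi / (1 / 2) = 2 * Real.pi by ring] at this
  rw [← this]
  refine integral_congr_ae (Filter.Eventually.of_forall fun x => ?_)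
  simp only [gauss, Real.norm_eq_abs, sq_abs]
  congr 1; ring

/-- The radial Gaussian moment `∫ r ^ n exp (-r² / 2) dr` over the positive half-line. -/
noncomputable def halfMoment (n : ℕ) : ℝ := ∫ r in Set.Ioi (0 : ℝ), r ^ n * gauss r

theorem halfMoment_eq (n : ℕ) :
    halfMoment n = 2 ^ (((n : ℝ) - 1) / 2) * Real.Gamma (((n : ℝ) + 1) / 2) := by
  have h := integral_rpow_mul_exp_neg_mul_rpow (p := 2) (q := n) (b := 1 / 2) (by norm_num)
    (by have : (0 : ℝ) ≤ n := n.cast_nonneg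
        linarith) (by norm_num)
  have h' : halfMoment n = ∫ x in Set.Ioi (0 : ℝ), x ^ (n : ℝ) * Real.exp (-(1 / 2) * x ^ (2 : ℝ)) := by
    refine setIntegral_congr_fun measurableSet_Ioi fun x _ => ?_
    simp only [gauss, Real.norm_eq_abs, sq_abs, Real.rpow_natCast]
    congr 2
    rw [show ((2 : ℝ)) = ((2 : ℕ) : ℝ) by norm_num, Real.rpow_natCast]
    push_cast; ring
  rw [h', h, one_div, Real.inv_rpow (by norm_num), ← Real.rpow_neg (by norm_num)]
  have : (2 : ℝ)⁻¹ = 2 ^ (-1 : ℝ) := by rw [Real.rpow_neg_one]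
  rw [this, ← Real.rpow_add (by norm_num)]
  congr 2
  ring

theorem integrableOn_halfMoment (n : ℕ) :
    IntegrableOn (fun r : ℝ => r ^ n * gauss r) (Set.Ioi 0) := by
  have h := integrableOn_rpow_mul_exp_neg_mul_sq (b := 1 / 2) (s := n) (by norm_num)
    (by have : (0 : ℝ) ≤ n := n.cast_nonneg
        linarith)
  refine h.congr_fun (fun x _ => ?_) measurableSet_Ioi
  simp only [gauss, Real.norm_eq_abs, sq_abs, Real.rpow_natCast]
  congr 2
  ring

theorem halfMoment_pos (n : ℕ) : 0 < halfMoment n := by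
  rw [halfMoment_eq]
  have : 0 < Real.Gamma (((n : ℝ) + 1) / 2) := Real.Gamma_pos_of_pos (by positivity)
  positivity

theorem integral_norm_mul_gauss (n : ℕ) :
    ∫ v : E (n + 1), ‖v‖ * gauss v =
      (n + 1) * (volume : Measure (E (n + 1))).real (Metric.ball 0 1) * halfMoment (n + 1) := by
  have h := integral_fun_norm_addHaar (volume : Measure (E (n + 1)))
    (fun r : ℝ => r * gauss r)
  simp only [finrank_euclideanSpace, Fintype.card_fin] at h
  have h2 : ∀ v : E (n + 1), ‖v‖ * gauss ‖v‖ = ‖v‖ * gauss v := fun v => by simp [gauss]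
  simp only [h2] at h
  rw [h, halfMoment]
  simp only [nsmul_eq_mul, smul_eq_mul, Nat.cast_add, Nat.cast_one, Nat.add_sub_cancel]
  rw [mul_assoc]
  congr 2
  refine setIntegral_congr_fun measurableSet_Ioi fun x _ => ?_
  ring

theorem integrable_norm_mul_gauss (n : ℕ) :
    Integrable fun v : E (n + 1) => ‖v‖ * gauss v := by
  have h := (integrable_fun_norm_addHaar (volume : Measure (E (n + 1)))
    (f := fun r : ℝ => r * gauss r)).2 ?_
  · refine h.congr (Filter.Eventually.of_forall fun v => by simp [gauss])
  · simp only [finrank_euclideanSpace, Fintype.card_fin, smul_eq_mul, Nat.add_sub_cancel]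
    refine (integrableOn_halfMoment (n + 1)).congr_fun (fun x _ => ?_) measurableSet_Ioi
    ring


/-! ### The Gaussian moment of the absolute determinant. -/

/-- The determinant of the matrix with rows `y i`. -/
noncomputable def rowDet {n : ℕ} (y : Fin n → E n) : ℝ := Matrix.det (Matrix.of fun i j => y i j)

theorem continuous_rowDet {n : ℕ} : Continuous (rowDet : (Fin n → E n) → ℝ) := by
  unfold rowDet
  refine Continuous.matrix_det ?_
  refine continuous_matrix fun i j => ?_
  simp only [Matrix.of_apply]
  fun_prop

/-- The Gaussian integral of the absolute value of the determinant. -/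
noncomputable def detMoment (n : ℕ) : ENNReal :=
  ∫⁻ y : Fin n → E n, ENNReal.ofReal (|rowDet y| * ∏ i, gauss (y i))

theorem abs_rowDet_linearIsometryEquiv {n : ℕ} (R : E n ≃ₗᵢ[ℝ] E n) (y : Fin n → E n) :
    |rowDet fun i => R (y i)| = |rowDet y| := by
  have h := (EuclideanSpace.basisFun (Fin n) ℝ).toBasis.det_comp R.toLinearEquiv.toLinearMap y
  have key : ∀ z : Fin n → E n, (EuclideanSpace.basisFun (Fin n) ℝ).toBasis.det z = rowDet z := by
    intro z
    rw [Module.Basis.det_apply, rowDet, ← Matrix.det_transpose]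
    congr 1
  rw [key] at h
  have h2 : rowDet (fun i => R (y i)) = LinearMap.det R.toLinearEquiv.toLinearMap * rowDet y := by
    rw [← key y, ← h]; rfl
  have h3 : |LinearMap.det R.toLinearEquiv.toLinearMap| = 1 := by
    rw [← LinearMap.normDet_eq_abs_det]
    exact R.toLinearIsometry.normDet_eq_one
  rw [h2, abs_mul, h3, one_mul]

/-- The reflection in the hyperplane orthogonal to `v - w` works. -/
theorem exists_linearIsometryEquiv_apply {V : Type*} [NormedAddCommGroup V] [InnerProductSpace ℝ V]
    {v w : V} (h : ‖v‖ = ‖w‖) : ∃ R : V ≃ₗᵢ[ℝ] V, R v = w :=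
  ⟨_, Submodule.reflection_sub h⟩

theorem measurePreserving_cons (n : ℕ) (V : Type) [MeasureSpace V]
    [SigmaFinite (volume : Measure V)] :
    MeasurePreserving (fun p : V × (Fin n → V) => (Fin.cons p.1 p.2 : Fin (n + 1) → V)) := by
  have h := (volume_preserving_piFinSuccAbove (fun _ : Fin (n + 1) => V) 0).symm
  have e : (fun p : V × (Fin n → V) => (Fin.cons p.1 p.2 : Fin (n + 1) → V)) =
      (MeasurableEquiv.piFinSuccAbove (fun _ : Fin (n + 1) => V) 0).symm := by
    funext p
    exact (Fin.insertNth_zero' _ _).symm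
  rw [e]
  exact h

/-- Splitting off the first coordinate of every row. -/
theorem measurePreserving_splitFirst (n m : ℕ) :
    MeasurePreserving (fun p : (Fin m → ℝ) × (Fin m → E n) => fun i =>
      (WithLp.toLp 2 (Fin.cons (p.1 i) (WithLp.ofLp (p.2 i)) : Fin (n + 1) → ℝ) : E (n + 1))) := by
  have h1 : MeasurePreserving (fun p : ℝ × E n =>
      (WithLp.toLp 2 (Fin.cons p.1 (WithLp.ofLp p.2) : Fin (n + 1) → ℝ) : E (n + 1))) := by
    have a := (MeasurePreserving.id (volume : Measure ℝ)).prod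
      (PiLp.volume_preserving_ofLp (Fin n))
    have b := measurePreserving_cons n ℝ
    have c := PiLp.volume_preserving_toLp (Fin (n + 1))
    exact (c.comp (b.comp a))
  have h2 := volume_preserving_pi (fun _ : Fin m => h1)
  have h3 := (volume_measurePreserving_arrowProdEquivProdArrow ℝ (E n) (Fin m)).symm
  exact h2.comp h3

theorem rowDet_cons_single {n : ℕ} (c : ℝ) (t : Fin n → ℝ) (z : Fin n → E n) :
    rowDet (Fin.cons (EuclideanSpace.single 0 c) fun i =>
      (WithLp.toLp 2 (Fin.cons (t i) (WithLp.ofLp (z i)) : Fin (n + 1) → ℝ) : E (n + 1)) :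
        Fin (n + 1) → E (n + 1)) = c * rowDet z := by
  rw [rowDet, Matrix.det_succ_row_zero, Finset.sum_eq_single 0]
  · simp [rowDet]
    left
    congr 1
  · intro j _ hj
    simp [hj]
  · simp

theorem gauss_cons {n : ℕ} (t : ℝ) (z : E n) :
    gauss (WithLp.toLp 2 (Fin.cons t (WithLp.ofLp z) : Fin (n + 1) → ℝ) : E (n + 1)) =
      gauss t * gauss z := by
  simp only [gauss, ← Real.exp_add, EuclideanSpace.norm_sq_eq, Fin.sum_univ_succ]
  congr 1
  simp
  ring

/-- Rotation invariance allows `v` to be replaced by `‖v‖ e_0`. Laplace expansion then leaves `‖v‖`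
times a smaller determinant, which does not see the first entries of the other rows; these integrate
to `√(2π)` each. -/
theorem lintegral_rowDet_cons {n : ℕ} (v : E (n + 1)) :
    ∫⁻ y : Fin n → E (n + 1), ENNReal.ofReal
      (|rowDet (Fin.cons v y : Fin (n + 1) → E (n + 1))| * ∏ i, gauss (y i)) =
    ENNReal.ofReal ‖v‖ * (ENNReal.ofReal (√(2 * Real.pi) ^ n) * detMoment n) := by
  obtain ⟨R, hR⟩ := exists_linearIsometryEquiv_apply (v := v)
    (w := (EuclideanSpace.single 0 ‖v‖ : E (n + 1))) (by simp)
  have hmp := volume_preserving_pi (fun _ : Fin n => R.measurePreserving)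
  have hc : Continuous fun y : Fin n → E (n + 1) =>
      |rowDet (Fin.cons (EuclideanSpace.single 0 ‖v‖ : E (n + 1)) y : Fin (n + 1) → E (n + 1))| *
        ∏ i, gauss (y i) := by
    refine (continuous_rowDet.comp ?_).abs.mul
      (continuous_finsetProd _ fun i _ => continuous_gauss.comp (continuous_apply i))
    refine continuous_pi fun i => ?_
    refine Fin.cases ?_ (fun i => ?_) i <;> simp <;> fun_prop
  have e1 : ∀ y : Fin n → E (n + 1),
      |rowDet (Fin.cons v y : Fin (n + 1) → E (n + 1))| * ∏ i, gauss (y i) =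
      |rowDet (Fin.cons (EuclideanSpace.single 0 ‖v‖ : E (n + 1)) (fun i => R (y i)) :
        Fin (n + 1) → E (n + 1))| * ∏ i, gauss (R (y i)) := by
    intro y
    rw [← abs_rowDet_linearIsometryEquiv R]
    congr 3
    · funext i
      refine Fin.cases ?_ (fun i => ?_) i <;> simp [hR]
    · simp [gauss]
  simp only [e1]
  rw [hmp.lintegral_comp (f := fun y : Fin n → E (n + 1) => ENNReal.ofReal
      (|rowDet (Fin.cons (EuclideanSpace.single 0 ‖v‖ : E (n + 1)) y : Fin (n + 1) → E (n + 1))| *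
        ∏ i, gauss (y i))) hc.measurable.ennreal_ofReal,
    ← (measurePreserving_splitFirst n n).lintegral_comp hc.measurable.ennreal_ofReal]
  simp only [rowDet_cons_single, gauss_cons, Finset.prod_mul_distrib]
  have e2 : ∀ p : (Fin n → ℝ) × (Fin n → E n), ENNReal.ofReal
      (|‖v‖ * rowDet p.2| * ((∏ i, gauss (p.1 i)) * ∏ i, gauss (p.2 i))) =
      ENNReal.ofReal (∏ i, gauss (p.1 i)) *
        (ENNReal.ofReal ‖v‖ * ENNReal.ofReal (|rowDet p.2| * ∏ i, gauss (p.2 i))) := by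
    intro p
    rw [← ENNReal.ofReal_mul (norm_nonneg _), ← ENNReal.ofReal_mul
      (Finset.prod_nonneg fun i _ => (gauss_pos _).le), abs_mul, abs_norm]
    congr 1; ring
  have hm1 : Measurable fun x : Fin n → ℝ => ENNReal.ofReal (∏ i, gauss (x i)) :=
    (continuous_finsetProd _ fun i _ =>
      continuous_gauss.comp (continuous_apply i)).measurable.ennreal_ofReal
  have hm2 : Measurable fun y : Fin n → E n => ENNReal.ofReal (|rowDet y| * ∏ i, gauss (y i)) :=
    (continuous_rowDet.abs.mul (continuous_finsetProd _ fun i _ =>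
      continuous_gauss.comp (continuous_apply i))).measurable.ennreal_ofReal
  simp only [e2]
  rw [Measure.volume_eq_prod, lintegral_prod_mul hm1.aemeasurable (hm2.const_mul _).aemeasurable,
    lintegral_const_mul _ hm2, lintegral_prod_eq_pow integrable_gauss_real
    (fun x => (gauss_pos x).le), integral_gauss_real, detMoment]
  ring

theorem detMoment_succ (n : ℕ) :
    detMoment (n + 1) = ENNReal.ofReal (∫ v : E (n + 1), ‖v‖ * gauss v) *
      (ENNReal.ofReal (√(2 * Real.pi) ^ n) * detMoment n) := by
  have hm : Measurable fun y : Fin (n + 1) → E (n + 1) =>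
      ENNReal.ofReal (|rowDet y| * ∏ i, gauss (y i)) :=
    (continuous_rowDet.abs.mul (continuous_finsetProd _ fun i _ =>
      continuous_gauss.comp (continuous_apply i))).measurable.ennreal_ofReal
  have : SigmaFinite (volume : Measure (E (n + 1))) := inferInstance
  have hmp := measurePreserving_cons n (E (n + 1))
  rw [detMoment, ← hmp.lintegral_comp hm]
  refine (lintegral_prod (μ := (volume : Measure (E (n + 1))))
    (ν := (volume : Measure (Fin n → E (n + 1)))) _ (hm.comp hmp.measurable).aemeasurable).trans ?_
  have e : ∀ v : E (n + 1), ∫⁻ y : Fin n → E (n + 1), ENNReal.ofReal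
      (|rowDet (Fin.cons v y : Fin (n + 1) → E (n + 1))| *
        ∏ i, gauss ((Fin.cons v y : Fin (n + 1) → E (n + 1)) i)) =
      ENNReal.ofReal (‖v‖ * gauss v) * (ENNReal.ofReal (√(2 * Real.pi) ^ n) * detMoment n) := by
    intro v
    rw [mul_comm ‖v‖, ENNReal.ofReal_mul (gauss_pos v).le, mul_assoc, ← lintegral_rowDet_cons,
      ← lintegral_const_mul' _ _ ENNReal.ofReal_ne_top]
    refine lintegral_congr fun y => ?_
    rw [← ENNReal.ofReal_mul (gauss_pos v).le, Fin.prod_univ_succ]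
    congr 1
    simp only [Fin.cons_zero, Fin.cons_succ]
    ring
  simp only [Function.comp_apply, e]
  rw [lintegral_mul_const _ (f := fun v : E (n + 1) => ENNReal.ofReal (‖v‖ * gauss v))
    (continuous_norm.mul continuous_gauss).measurable.ennreal_ofReal,
    ← ofReal_integral_eq_lintegral_ofReal (integrable_norm_mul_gauss n)
    (Filter.Eventually.of_forall fun v => mul_nonneg (norm_nonneg _) (gauss_pos v).le)]

theorem detMoment_eq (n : ℕ) :
    detMoment n = ENNReal.ofReal ((2 * Real.pi) ^ ((n : ℝ) ^ 2 / 2) * 2 ^ ((n : ℝ) / 2) *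
      Real.Gamma (((n : ℝ) + 1) / 2) / √Real.pi) := by
  induction n with
  | zero =>
    have h1 : √Real.pi / √Real.pi = 1 := div_self (by positivity)
    have hg : Real.Gamma 2⁻¹ = √Real.pi := by rw [← one_div, Real.Gamma_one_half_eq]
    simp [detMoment, rowDet, volume_pi, hg, h1]
  | succ n ih =>
    rw [detMoment_succ, ih, ← ENNReal.ofReal_mul (by positivity), ← ENNReal.ofReal_mul
      (integral_nonneg fun v => mul_nonneg (norm_nonneg _) (gauss_pos v).le),
      integral_norm_mul_gauss, halfMoment_eq, Measure.real, EuclideanSpace.volume_ball]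
    congr 1
    have hG : 0 < Real.Gamma (((n : ℝ) + 1) / 2) := Real.Gamma_pos_of_pos (by positivity)
    -- The Gamma factors telescope: the ball volume contributes this one in the denominator,
    -- cancelling the Gamma factor of the induction hypothesis, and the radial moment supplies the
    -- next.
    have hG2 : Real.Gamma (((n + 1 : ℕ) : ℝ) / 2 + 1) =
        ((n : ℝ) + 1) / 2 * Real.Gamma (((n : ℝ) + 1) / 2) := by
      rw [Real.Gamma_add_one (by positivity)]; push_cast; rfl
    have hp : 0 < √Real.pi := by positivity
    simp only [Fintype.card_fin, ENNReal.ofReal_one, one_pow, one_mul]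
    rw [ENNReal.toReal_ofReal (by rw [hG2]; positivity), hG2]
    have hs : √(2 * Real.pi) ^ n = 2 ^ ((n : ℝ) / 2) * Real.pi ^ ((n : ℝ) / 2) := by
      rw [Real.sqrt_eq_rpow, ← Real.rpow_natCast, ← Real.rpow_mul (by positivity),
        Real.mul_rpow (by norm_num) Real.pi_pos.le]
      congr 2 <;> ring
    have hs2 : √Real.pi ^ (n + 1) = Real.pi ^ (((n : ℝ) + 1) / 2) := by
      rw [Real.sqrt_eq_rpow, ← Real.rpow_natCast, ← Real.rpow_mul Real.pi_pos.le]
      congr 1; push_cast; ring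
    rw [hs, hs2, Real.mul_rpow (by norm_num) Real.pi_pos.le,
      Real.mul_rpow (by norm_num) Real.pi_pos.le]
    push_cast
    have key2 : (2 : ℝ) ^ ((n : ℝ) / 2) * (2 ^ ((n : ℝ) / 2) * (2 ^ ((n : ℝ) ^ 2 / 2) *
        2 ^ ((n : ℝ) / 2))) * 2 = 2 ^ (((n : ℝ) + 1) ^ 2 / 2) * 2 ^ (((n : ℝ) + 1) / 2) := by
      have h2 : (0 : ℝ) < 2 := by norm_num
      rw [← Real.rpow_add h2, ← Real.rpow_add h2, ← Real.rpow_add h2, ← Real.rpow_add h2,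
        ← Real.rpow_add_one h2.ne']
      congr 1; ring
    have keyp : Real.pi ^ (((n : ℝ) + 1) / 2) * (Real.pi ^ ((n : ℝ) / 2) *
        Real.pi ^ ((n : ℝ) ^ 2 / 2)) = Real.pi ^ (((n : ℝ) + 1) ^ 2 / 2) := by
      simp only [← Real.rpow_add Real.pi_pos]
      congr 1; ring
    rw [← keyp, add_sub_cancel_right]
    calc _ = (2 : ℝ) ^ ((n : ℝ) / 2) * (2 ^ ((n : ℝ) / 2) * (2 ^ ((n : ℝ) ^ 2 / 2) *
        2 ^ ((n : ℝ) / 2))) * 2 * (Real.pi ^ (((n : ℝ) + 1) / 2) * (Real.pi ^ ((n : ℝ) / 2) *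
        Real.pi ^ ((n : ℝ) ^ 2 / 2))) * Real.Gamma (((n : ℝ) + 1 + 1) / 2) / √Real.pi := by
          field_simp
      _ = _ := by rw [key2]; ring


/-! ### The cone condition and its sign symmetry. -/

variable {d : ℕ} [NeZero d]

/-- The index of the last coordinate, which measures the height. -/
def lastIdx (d : ℕ) [NeZero d] : Fin d := ⟨d - 1, Nat.sub_one_lt (NeZero.ne d)⟩

/-- The upward unit vector `e_d`. -/
noncomputable def up (d : ℕ) [NeZero d] : E d := EuclideanSpace.single (lastIdx d) 1

theorem inner_up (x : E d) : inner ℝ x (up d) = height x := by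
  simp only [up, height, lastIdx, EuclideanSpace.inner_single_right, one_mul]
  rfl

/-- The determinant in which the row `i` is replaced by `-e_d`. -/
noncomputable def replDet (y : Fin d → E d) (i : Fin d) : ℝ :=
  rowDet (Function.update y i (-up d))

/-- The systems of vectors for which `-e_d` is in the interior of the cone they generate. -/
def downCone (d : ℕ) [NeZero d] : Set (Fin d → E d) := {y | ∀ i, 0 < rowDet y * replDet y i}

theorem continuous_replDet (i : Fin d) : Continuous fun y : Fin d → E d => replDet y i :=
  continuous_rowDet.comp (continuous_id.update i continuous_const)

theorem isOpen_downCone : IsOpen (downCone d) := by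
  have : downCone d = ⋂ i, {y | 0 < rowDet y * replDet y i} := by
    ext y; simp [downCone]
  rw [this]
  exact isOpen_iInter_of_finite fun i =>
    isOpen_lt continuous_const (continuous_rowDet.mul (continuous_replDet i))

theorem rowDet_ne_zero_of_mem {y : Fin d → E d} (hy : y ∈ downCone d) : rowDet y ≠ 0 := by
  intro h
  have := hy (lastIdx d)
  simp [h] at this

/-- Cramer's rule: only the `i`-th summand survives by alternation. -/
theorem rowDet_update_sum {n : ℕ} (y : Fin n → E n) (c : Fin n → ℝ) (i : Fin n) :
    rowDet (Function.update y i (∑ k, c k • y k)) = c i * rowDet y := by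
  have h := Matrix.det_updateRow_sum (Matrix.of fun i j => y i j) i c
  rw [rowDet, rowDet, ← smul_eq_mul, ← h]
  congr 1
  ext k j
  by_cases hk : k = i
  · subst hk; simp
  · simp [Matrix.updateRow_apply, hk]

theorem linearIndependent_of_rowDet_ne_zero {n : ℕ} {y : Fin n → E n} (h : rowDet y ≠ 0) :
    LinearIndependent ℝ y := by
  have h1 := Matrix.linearIndependent_rows_of_det_ne_zero h
  rw [Fintype.linearIndependent_iff] at h1 ⊢
  intro g hg
  apply h1
  ext j
  have := congrArg (fun v : E n => v j) hg
  simpa using this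

theorem rowDet_ne_zero_of_linearIndependent {n : ℕ} {y : Fin n → E n}
    (h : LinearIndependent ℝ y) : rowDet y ≠ 0 := by
  have h1 : LinearIndependent ℝ (Matrix.of fun i j => y i j).row := by
    rw [Fintype.linearIndependent_iff] at h ⊢
    intro g hg
    apply h
    ext j
    have := congrFun hg j
    simpa using this
  rw [Matrix.linearIndependent_rows_iff_isUnit, Matrix.isUnit_iff_isUnit_det] at h1
  exact h1.ne_zero

/-- By Cramer's rule the coefficient of `y i` in `-e_d` is `replDet y i / rowDet y`, which has the
sign of the product. The determinants serve for measure theory, the coefficients for geometry. -/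
theorem mem_downCone_iff {y : Fin d → E d} :
    y ∈ downCone d ↔ LinearIndependent ℝ y ∧ ∃ c : Fin d → ℝ, (∀ i, 0 < c i) ∧
      ∑ i, c i • y i = -up d := by
  constructor
  · intro hy
    have h0 := rowDet_ne_zero_of_mem hy
    have hl := linearIndependent_of_rowDet_ne_zero h0
    refine ⟨hl, ?_⟩
    have hs := hl.span_eq_top_of_card_eq_finrank (by simp)
    have : -up d ∈ Submodule.span ℝ (Set.range y) := by rw [hs]; trivial
    obtain ⟨c, hc⟩ := (Submodule.mem_span_range_iff_exists_fun ℝ).1 this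
    refine ⟨c, fun i => ?_, hc⟩
    have h := hy i
    rw [replDet, ← hc, rowDet_update_sum] at h
    have h2 : 0 < rowDet y ^ 2 := by positivity
    have h3 : 0 < c i * rowDet y ^ 2 := by linarith [h]
    exact (pos_iff_pos_of_mul_pos h3).2 h2
  · rintro ⟨hl, c, hc, hs⟩ i
    have h0 := rowDet_ne_zero_of_linearIndependent hl
    rw [replDet, ← hs, rowDet_update_sum]
    have h2 : 0 < rowDet y ^ 2 := by positivity
    nlinarith [mul_pos (hc i) h2]

theorem rowDet_smul {n : ℕ} (t : Fin n → ℝ) (y : Fin n → E n) :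
    rowDet (fun i => t i • y i) = (∏ i, t i) * rowDet y := by
  rw [rowDet, rowDet, ← Matrix.det_mul_column]
  rfl

/-- Row `i` is absent from `replDet y i`, so every factor except `t i` occurs squared. Hence only
the sign of `t i` affects condition `i`. -/
theorem rowDet_mul_replDet_smul (t : Fin d → ℝ) (y : Fin d → E d) (i : Fin d) :
    rowDet (fun j => t j • y j) * replDet (fun j => t j • y j) i =
      t i * (∏ j, Function.update t i 1 j) ^ 2 * (rowDet y * replDet y i) := by
  have h1 : Function.update (fun j => t j • y j) i (-up d) =
      fun j => Function.update t i 1 j • Function.update y i (-up d) j := by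
    funext j
    by_cases hj : j = i
    · subst hj; simp
    · simp [hj]
  have h2 : ∏ j, t j = t i * ∏ j, Function.update t i 1 j := by
    rw [Finset.prod_update_of_mem (Finset.mem_univ i), one_mul, Finset.sdiff_singleton_eq_erase,
      Finset.mul_prod_erase _ _ (Finset.mem_univ i)]
  rw [replDet, h1, rowDet_smul, rowDet_smul, h2, replDet]
  ring

theorem prod_update_ne_zero {n : ℕ} {t : Fin n → ℝ} (ht : ∀ i, t i ≠ 0) (i : Fin n) :
    ∏ j, Function.update t i 1 j ≠ 0 := by
  refine Finset.prod_ne_zero_iff.2 fun j _ => ?_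
  by_cases hj : j = i
  · subst hj; simp
  · simp [hj, ht]

theorem smul_mem_downCone_iff {t : Fin d → ℝ} (ht : ∀ i, t i ≠ 0) (y : Fin d → E d) :
    (fun i => t i • y i) ∈ downCone d ↔ ∀ i, 0 < t i * (rowDet y * replDet y i) := by
  refine forall_congr' fun i => ?_
  rw [rowDet_mul_replDet_smul, mul_assoc, mul_left_comm]
  have := prod_update_ne_zero ht i
  exact mul_pos_iff_of_pos_left (by positivity)

theorem smul_mem_downCone {t : Fin d → ℝ} (ht : ∀ i, 0 < t i) {y : Fin d → E d}
    (hy : y ∈ downCone d) : (fun i => t i • y i) ∈ downCone d :=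
  (smul_mem_downCone_iff (fun i => (ht i).ne') y).2 fun i => mul_pos (ht i) (hy i)

/-- Factoring out `B` leaves a characteristic polynomial in `t`, which is monic. -/
theorem finite_setOf_det_add_smul_eq_zero {n : ℕ} (A B : Matrix (Fin n) (Fin n) ℝ)
    (hB : B.det ≠ 0) : {t : ℝ | (A + t • B).det = 0}.Finite := by
  have hu : IsUnit B.det := hB.isUnit
  have key : ∀ t : ℝ, (A + t • B).det = B.det * (-(B⁻¹ * A)).charpoly.eval t := by
    intro t
    rw [Matrix.eval_charpoly, ← Matrix.det_mul]
    congr 1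
    rw [sub_neg_eq_add, mul_add, ← mul_assoc, Matrix.mul_nonsing_inv _ hu, one_mul, add_comm]
    congr 1
    ext i j
    simp [mul_comm]
  refine ((-(B⁻¹ * A)).charpoly.roots.toFinset.finite_toSet).subset fun t ht => ?_
  have h0 : (-(B⁻¹ * A)).charpoly ≠ 0 := (Matrix.charpoly_monic _).ne_zero
  simp only [Set.mem_ofPred_eq, key, mul_eq_zero, hB, false_or] at ht
  simp [h0, Polynomial.IsRoot, ht]

/-- Fubini along the lines parallel to `v`: each meets the zero set in a null set. -/
theorem ae_ne_zero_of_finite_line {n : ℕ} {f : (Fin n → E n) → ℝ} (hf : Continuous f)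
    (v : Fin n → E n) (h : ∀ y, {t : ℝ | f (y + t • v) = 0}.Finite) : ∀ᵐ y, f y ≠ 0 := by
  refine ae_mem_of_ae_add_linearMap_mem (LinearMap.toSpanSingleton ℝ (Fin n → E n) v)
    (volume : Measure ℝ) volume (s := {y | f y ≠ 0})
    (isOpen_ne_fun hf continuous_const).measurableSet fun y => ?_
  have := (h y).measure_zero volume
  rw [ae_iff]
  simpa using this

theorem ae_rowDet_ne_zero (n : ℕ) : ∀ᵐ y : Fin n → E n, rowDet y ≠ 0 := by
  refine ae_ne_zero_of_finite_line continuous_rowDet (fun i => EuclideanSpace.single i 1)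
    fun y => ?_
  have key : ∀ t : ℝ, rowDet (y + t • fun i => EuclideanSpace.single i 1) =
      ((Matrix.of fun i j => y i j) + t • (1 : Matrix (Fin n) (Fin n) ℝ)).det := by
    intro t
    rw [rowDet]
    congr 1
    ext i j
    simp [Matrix.one_apply, eq_comm]
  simp only [key]
  exact finite_setOf_det_add_smul_eq_zero _ 1 (by simp)

/-- The direction `B` is an invertible matrix whose row `i` is `-e_d`. If row `i` of `y` is cleared,
then `y + t B` has `t (-e_d)` in that row, and its determinant is `t` times the required one. Only
`t = 0` must be added by hand. -/
theorem ae_replDet_ne_zero (i : Fin d) : ∀ᵐ y : Fin d → E d, replDet y i ≠ 0 := by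
  let σ := Equiv.swap i (lastIdx d)
  let B : Matrix (Fin d) (Fin d) ℝ := -(σ.permMatrix ℝ)
  have hB : B.det ≠ 0 := by
    simp only [B, Matrix.det_neg, Matrix.det_permutation]
    rcases Int.units_eq_one_or (Equiv.Perm.sign σ) with h | h <;> simp [h]
  refine ae_ne_zero_of_finite_line (continuous_replDet i)
    (fun k => WithLp.toLp 2 (B k)) fun y => ?_
  refine ((finite_setOf_det_add_smul_eq_zero
    ((Matrix.of fun i j => y i j).updateRow i 0) B hB).union (Set.finite_singleton 0)).subset ?_
  intro t ht
  by_cases h0 : t = 0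
  · exact Or.inr h0
  left
  have h1 : (Matrix.of fun i j => y i j).updateRow i 0 + t • B =
      ((Matrix.of fun i j => y i j) + t • B).updateRow i (t • fun j => (-up d) j) := by
    ext k j
    by_cases hk : k = i
    · subst hk
      simp [B, σ, up, Equiv.Perm.permMatrix, PEquiv.toMatrix_apply, eq_comm]
    · simp [hk]
  have h2 : replDet (y + t • fun k => WithLp.toLp 2 (B k)) i =
      (((Matrix.of fun i j => y i j) + t • B).updateRow i fun j => (-up d) j).det := by
    rw [replDet, rowDet]
    congr 1
    ext k j
    by_cases hk : k = i
    · subst hk; simp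
    · simp [hk]
  rw [Set.mem_ofPred_eq, h2] at ht
  rw [Set.mem_ofPred_eq, h1, Matrix.det_updateRow_smul, ht, mul_zero]

/-- The action of a system of signs on the rows. -/
def signMap {n : ℕ} (ε : Fin n → ℤˣ) (y : Fin n → E n) : Fin n → E n := fun i => ((ε i : ℤ) : ℝ) • y i

theorem measurePreserving_signMap {n : ℕ} (ε : Fin n → ℤˣ) : MeasurePreserving (signMap ε) := by
  refine volume_preserving_pi (f := fun i (v : E n) => ((ε i : ℤ) : ℝ) • v) fun i => ?_
  rcases Int.units_eq_one_or (ε i) with h | h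
  · simp only [h, Units.val_one, Int.cast_one, one_smul]
    exact MeasurePreserving.id (volume : Measure (E n))
  · simpa [h] using Measure.measurePreserving_neg (volume : Measure (E n))

/-- Flipping signs of rows preserves measure and integrand. Almost every `y` is carried into the
cone by exactly one of the `2 ^ d` sign patterns, the signs of its Cramer coefficients. -/
theorem detMoment_eq_downCone :
    detMoment d = 2 ^ d * ∫⁻ y in downCone d, ENNReal.ofReal (|rowDet y| * ∏ i, gauss (y i)) := by
  set f : (Fin d → E d) → ENNReal := fun y => ENNReal.ofReal (|rowDet y| * ∏ i, gauss (y i))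
    with hf
  have hfm : Measurable f := (continuous_rowDet.abs.mul (continuous_finsetProd _ fun i _ =>
      continuous_gauss.comp (continuous_apply i))).measurable.ennreal_ofReal
  have hm : MeasurableSet (downCone d) := isOpen_downCone.measurableSet
  have hε : ∀ (ε : Fin d → ℤˣ) i, ((ε i : ℤ) : ℝ) ≠ 0 := fun ε i => by
    rcases Int.units_eq_one_or (ε i) with h | h <;> simp [h]
  have habs : ∀ (ε : Fin d → ℤˣ) i, |((ε i : ℤ) : ℝ)| = 1 := fun ε i => by
    rcases Int.units_eq_one_or (ε i) with h | h <;> simp [h]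
  have hinv : ∀ ε y, f (signMap ε y) = f y := by
    intro ε y
    have h1 : rowDet (signMap ε y) = _ := rowDet_smul _ y
    have h2 : ∀ i, ‖signMap ε y i‖ = ‖y i‖ := fun i => by
      rw [signMap, norm_smul, Real.norm_eq_abs, habs, one_mul]
    simp only [hf, h1, gauss, h2, abs_mul, Finset.abs_prod, habs, Finset.prod_const_one, one_mul]
  have hae : ∀ᵐ y : Fin d → E d, f y = ∑ ε : Fin d → ℤˣ, (downCone d).indicator f (signMap ε y) := by
    filter_upwards [ae_rowDet_ne_zero d, ae_all_iff.2 ae_replDet_ne_zero] with y h1 h2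
    let ε₀ : Fin d → ℤˣ := fun i => if 0 < rowDet y * replDet y i then 1 else -1
    rw [Finset.sum_eq_single ε₀]
    · rw [Set.indicator_of_mem, hinv]
      refine (smul_mem_downCone_iff (hε _) y).2 fun i => ?_
      by_cases hi : 0 < rowDet y * replDet y i
      · simp [ε₀, hi]
      · have := lt_of_le_of_ne (not_lt.1 hi) (mul_ne_zero h1 (h2 i))
        simpa [ε₀, hi] using this
    · intro ε _ hne
      refine Set.indicator_of_notMem (fun hmem => hne ?_) _
      have h := (smul_mem_downCone_iff (hε ε) y).1 hmem
      funext i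
      have hi := h i
      rcases Int.units_eq_one_or (ε i) with h' | h'
      · have : 0 < rowDet y * replDet y i := by simpa [h'] using hi
        simp [ε₀, h', this]
      · have : ¬ 0 < rowDet y * replDet y i := by
          rw [h'] at hi
          push_cast at hi
          linarith
        simp [ε₀, h', this]
    · simp
  rw [detMoment, lintegral_congr_ae hae, lintegral_finsetSum]
  · have : ∀ ε : Fin d → ℤˣ, ∫⁻ y, (downCone d).indicator f (signMap ε y) =
        ∫⁻ y in downCone d, f y := fun ε => by
      rw [(measurePreserving_signMap ε).lintegral_comp (hfm.indicator hm), lintegral_indicator hm]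
    simp [this]
  · exact fun ε _ => (hfm.indicator hm).comp (measurePreserving_signMap ε).measurable


/-! ### Geometry of the spheres: local minima and the cone. -/

theorem norm_le_norm_sub_iff {V : Type*} [NormedAddCommGroup V] [InnerProductSpace ℝ V] (y v : V) :
    ‖y‖ ≤ ‖y - v‖ ↔ 2 * inner ℝ v y ≤ ‖v‖ ^ 2 := by
  rw [← sq_le_sq₀ (norm_nonneg _) (norm_nonneg _), norm_sub_sq_real, real_inner_comm]
  constructor <;> intro h <;> linarith

theorem norm_sub_eq_norm_iff {V : Type*} [NormedAddCommGroup V] [InnerProductSpace ℝ V] (y v : V) :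
    ‖y - v‖ = ‖y‖ ↔ 2 * inner ℝ v y = ‖v‖ ^ 2 := by
  rw [← sq_eq_sq₀ (norm_nonneg _) (norm_nonneg _), norm_sub_sq_real, real_inner_comm]
  constructor <;> intro h <;> linarith

theorem exists_innerEquiv {n : ℕ} {y : Fin n → E n} (hy : LinearIndependent ℝ y) :
    ∃ T : E n ≃L[ℝ] (Fin n → ℝ), ∀ v i, T v i = inner ℝ v (y i) := by
  let f : E n →ₗ[ℝ] (Fin n → ℝ) :=
    LinearMap.pi fun i => (innerₗ (E n)).flip (y i)
  have hf : ∀ v i, f v i = inner ℝ v (y i) := fun v i => rfl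
  have hinj : Function.Injective f := by
    rw [← LinearMap.ker_eq_bot, LinearMap.ker_eq_bot']
    intro v hv
    have hs := hy.span_eq_top_of_card_eq_finrank' (by simp)
    have hmem : v ∈ (Submodule.span ℝ (Set.range y))ᗮ := by
      rw [Submodule.mem_orthogonal']
      intro u hu
      induction hu using Submodule.span_induction with
      | mem u hu =>
        obtain ⟨i, rfl⟩ := hu
        rw [← hf, hv]; rfl
      | zero => simp
      | add a b _ _ ha hb => rw [inner_add_right, ha, hb, add_zero]
      | smul a b _ hb => rw [inner_smul_right, hb, mul_zero]
    rw [hs, Submodule.top_orthogonal_eq_bot] at hmem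
    exact hmem
  refine ⟨(f.linearEquivOfInjective hinj (by simp)).toContinuousLinearEquiv, fun v i => ?_⟩
  rw [← hf]; rfl

theorem height_eq_neg_sum {y : Fin d → E d} {c : Fin d → ℝ} (hc : ∑ i, c i • y i = -up d) (v : E d) :
    height v = -∑ i, c i * inner ℝ v (y i) := by
  have : ∑ i, c i * inner ℝ v (y i) = inner ℝ v (∑ i, c i • y i) := by
    rw [inner_sum]
    exact Finset.sum_congr rfl fun i _ => (inner_smul_right _ _ _).symm
  rw [this, hc, inner_neg_right, neg_neg, inner_up]

/-- The equations read `2⟪w, y i⟫ = ‖w‖ ^ 2`, so all `⟪w, y i⟫` agree and `w` lies on the line of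
the vector `n` with `⟪n, y i⟫ = 1`. On that line the solutions are `0` and `(2 / ‖n‖ ^ 2) • n`. The
height of `n` is `-∑ c i < 0`. -/
theorem exists_second_intersection {y : Fin d → E d} (hy : y ∈ downCone d) :
    ∃ w₀ : E d, w₀ ≠ 0 ∧ height w₀ < 0 ∧
      ∀ w, (∀ i, ‖y i - w‖ = ‖y i‖) ↔ w = 0 ∨ w = w₀ := by
  obtain ⟨hl, c, hc, hs⟩ := mem_downCone_iff.1 hy
  obtain ⟨T, hT⟩ := exists_innerEquiv hl
  let n : E d := T.symm fun _ => 1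
  have hn : ∀ i, inner ℝ n (y i) = 1 := fun i => by rw [← hT]; simp [n]
  have hn0 : n ≠ 0 := by
    intro h
    have := hn (lastIdx d)
    simp [h] at this
  have hnn : 0 < ‖n‖ := norm_pos_iff.2 hn0
  have hpos : 0 < 2 / ‖n‖ ^ 2 := by positivity
  have hC : 0 < ∑ i, c i := Finset.sum_pos (fun i _ => hc i) ⟨lastIdx d, Finset.mem_univ _⟩
  refine ⟨(2 / ‖n‖ ^ 2) • n, smul_ne_zero hpos.ne' hn0, ?_, fun w => ?_⟩
  · rw [height_eq_neg_sum hs]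
    simp only [real_inner_smul_left, hn, mul_one, ← Finset.sum_mul]
    have := mul_pos hC hpos
    linarith
  · simp only [norm_sub_eq_norm_iff]
    constructor
    · intro h
      have hw : w = (‖w‖ ^ 2 / 2) • n := by
        apply T.injective
        funext i
        rw [hT, hT, real_inner_smul_left, hn]
        linarith [h i]
      by_cases h0 : w = 0
      · exact Or.inl h0
      right
      have hw0 : 0 < ‖w‖ := norm_pos_iff.2 h0
      have h1 : ‖w‖ = ‖w‖ ^ 2 / 2 * ‖n‖ := by
        conv_lhs => rw [hw, norm_smul, Real.norm_eq_abs, abs_of_nonneg (by positivity)]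
      have h2 : ‖w‖ * ‖n‖ = 2 := by
        have : ‖w‖ * (‖w‖ * ‖n‖ - 2) = 0 := by linarith
        rcases mul_eq_zero.1 this with h | h <;> linarith
      have h3 : ‖w‖ ^ 2 / 2 = 2 / ‖n‖ ^ 2 := by
        rw [div_eq_div_iff (by norm_num) (by positivity)]
        nlinarith
      rw [← h3, ← hw]
    · rintro (rfl | rfl) i
      · simp
      · rw [real_inner_smul_left, hn, norm_smul, Real.norm_eq_abs, abs_of_pos hpos]
        field_simp

/-- The largest coordinate `⟪v, y j⟫` has size at least `‖v‖ / K`. For small `v` it cannot be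
positive, since admissible coordinates are at most `‖v‖ ^ 2 / 2`. It therefore raises the height
linearly in `‖v‖`, while the others lower it at most quadratically. -/
theorem exists_forall_height_pos_of_mem {y : Fin d → E d} (hy : y ∈ downCone d) :
    ∃ δ > 0, ∀ v : E d, ‖v‖ < δ → v ≠ 0 → (∀ i, ‖y i‖ ≤ ‖y i - v‖) → 0 < height v := by
  obtain ⟨hl, c, hc, hs⟩ := mem_downCone_iff.1 hy
  obtain ⟨T, hT⟩ := exists_innerEquiv hl
  have : Nonempty (Fin d) := ⟨lastIdx d⟩
  obtain ⟨i₀, hi₀⟩ := Finite.exists_min c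
  have hC : 0 < ∑ i, c i := Finset.sum_pos (fun i _ => hc i) ⟨lastIdx d, Finset.mem_univ _⟩
  set K := ‖(T.symm : (Fin d → ℝ) →L[ℝ] E d)‖ + 1 with hK
  have hK0 : 0 < K := by positivity
  have hKv : ∀ v, ‖v‖ ≤ K * ‖T v‖ := fun v => by
    have h1 := (T.symm : (Fin d → ℝ) →L[ℝ] E d).le_opNorm (T v)
    have h2 : (T.symm : (Fin d → ℝ) →L[ℝ] E d) (T v) = v := by simp
    rw [h2] at h1
    nlinarith [norm_nonneg (T v)]
  -- The first bound rules out a positive extremal coordinate; the second makes the linear gain beat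
  -- the quadratic loss.
  refine ⟨min (1 / K) (c i₀ / (K * ∑ i, c i)), lt_min (by positivity)
    (div_pos (hc _) (mul_pos hK0 hC)), fun v hv hv0 h => ?_⟩
  simp only [norm_le_norm_sub_iff] at h
  have hv1 := lt_of_lt_of_le hv (min_le_left _ _)
  have hv2 := lt_of_lt_of_le hv (min_le_right _ _)
  rw [lt_div_iff₀ hK0] at hv1
  rw [lt_div_iff₀ (mul_pos hK0 hC)] at hv2
  have hvn : 0 < ‖v‖ := norm_pos_iff.2 hv0
  obtain ⟨j, hj⟩ := Finite.exists_max fun i => ‖T v i‖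
  have hTj : ‖T v‖ ≤ ‖T v j‖ := (pi_norm_le_iff_of_nonneg (norm_nonneg _)).2 hj
  have hKj : ‖v‖ ≤ K * |T v j| := (hKv v).trans (mul_le_mul_of_nonneg_left hTj hK0.le)
  have hneg : T v j ≤ 0 := by
    by_contra hp
    push Not at hp
    rw [abs_of_pos hp] at hKj
    have := h j
    rw [← hT] at this
    nlinarith
  rw [abs_of_nonpos hneg] at hKj
  rw [height_eq_neg_sum hs]
  have hterm : ∀ i, 0 ≤ c i * (‖v‖ ^ 2 / 2 - inner ℝ v (y i)) := fun i =>
    mul_nonneg (hc i).le (by linarith [h i])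
  have hsum := Finset.single_le_sum (fun i _ => hterm i) (Finset.mem_univ j)
  simp only [mul_sub, Finset.sum_sub_distrib, ← Finset.sum_mul] at hsum
  rw [← hT v j] at hsum
  have h1 : c i₀ * ‖v‖ ≤ c j * (K * -T v j) :=
    mul_le_mul (hi₀ j) hKj hvn.le (hc j).le
  have h2 : ‖v‖ * (‖v‖ * (K * ∑ i, c i)) < ‖v‖ * c i₀ := mul_lt_mul_of_pos_left hv2 hvn
  have h3 : 0 < c j * ‖v‖ ^ 2 := mul_pos (hc j) (by positivity)
  have h4 : 0 < K * -∑ i, c i * inner ℝ v (y i) := by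
    nlinarith [mul_le_mul_of_nonneg_left hsum hK0.le, mul_pos hK0 h3, mul_pos (mul_pos hK0 hC) (pow_pos hvn 2)]
  exact (mul_pos_iff_of_pos_left hK0).1 h4

/-- Nonzero vectors of the polar cone are admissible after shrinking, so they have positive height.
A vector orthogonal to all `y i` would give this for both `v` and `-v`, so the `y i` form a basis.
The negative of the `j`-th dual basis vector has height `c j`. -/
theorem mem_downCone_of_forall_height_pos {y : Fin d → E d} {δ : ℝ} (hδ : 0 < δ)
    (H : ∀ v : E d, ‖v‖ < δ → v ≠ 0 → (∀ i, ‖y i‖ ≤ ‖y i - v‖) → 0 < height v) :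
    y ∈ downCone d := by
  have H' : ∀ v : E d, v ≠ 0 → (∀ i, inner ℝ v (y i) ≤ 0) → 0 < height v := by
    intro v hv h
    have hn : 0 < ‖v‖ := norm_pos_iff.2 hv
    have ht : 0 < δ / (2 * ‖v‖) := by positivity
    have := H ((δ / (2 * ‖v‖)) • v) ?_ (smul_ne_zero ht.ne' hv) fun i => ?_
    · rw [← inner_up, real_inner_smul_left, inner_up] at this
      exact (mul_pos_iff_of_pos_left ht).1 this
    · rw [norm_smul, Real.norm_eq_abs, abs_of_pos ht]
      field_simp
      linarith
    · rw [norm_le_norm_sub_iff, real_inner_smul_left]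
      have := mul_nonneg ht.le (neg_nonneg.2 (h i))
      nlinarith [sq_nonneg ‖(δ / (2 * ‖v‖)) • v‖]
  have hspan : Submodule.span ℝ (Set.range y) = ⊤ := by
    by_contra hne
    rw [← Submodule.orthogonal_eq_bot_iff] at hne
    obtain ⟨v, hv, hv0⟩ := Submodule.exists_mem_ne_zero_of_ne_bot hne
    have h0 : ∀ i, inner ℝ v (y i) = 0 := fun i =>
      (Submodule.mem_orthogonal' _ _).1 hv _ (Submodule.subset_span ⟨i, rfl⟩)
    have h1 := H' v hv0 fun i => (h0 i).le
    have h2 := H' (-v) (neg_ne_zero.2 hv0) fun i => by rw [inner_neg_left, h0, neg_zero]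
    rw [← inner_up, inner_neg_left, inner_up] at h2
    linarith
  have hl : LinearIndependent ℝ y :=
    linearIndependent_of_top_le_span_of_card_eq_finrank hspan.ge (by simp)
  have hmem : -up d ∈ Submodule.span ℝ (Set.range y) := by rw [hspan]; trivial
  obtain ⟨c, hc⟩ := (Submodule.mem_span_range_iff_exists_fun ℝ).1 hmem
  refine mem_downCone_iff.2 ⟨hl, c, fun j => ?_, hc⟩
  obtain ⟨T, hT⟩ := exists_innerEquiv hl
  have h1 : ∀ i, inner ℝ (T.symm (-Pi.single j 1)) (y i) = -(Pi.single j 1 : Fin d → ℝ) i :=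
    fun i => by rw [← hT]; simp
  have h2 := H' (T.symm (-Pi.single j 1)) (by simp) fun i => by
    rw [h1, Pi.single_apply]; split_ifs <;> simp
  rw [height_eq_neg_sum hc] at h2
  simp only [h1, Pi.single_apply] at h2
  simpa using h2

/-- The centres `0, x₂, …, x_d`. -/
def center (x : {i : Fin d // i ≠ 0} → E d) (i : Fin d) : E d := if h : i ≠ 0 then x ⟨i, h⟩ else 0

theorem center_zero (x : {i : Fin d // i ≠ 0} → E d) : center x 0 = 0 := by simp [center]

theorem center_coe (x : {i : Fin d // i ≠ 0} → E d) (i : {i : Fin d // i ≠ 0}) :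
    center x i = x i := by
  simp [center, i.2]

theorem config_eq_range (a : Fin d → ℝ≥0) (x : {i : Fin d // i ≠ 0} → E d) :
    config a x = Set.range fun i => (center x i, a i) := by
  ext z
  simp only [config, Set.mem_insert_iff, Set.mem_range]
  constructor
  · rintro (rfl | ⟨i, rfl⟩)
    · exact ⟨0, by rw [center_zero]⟩
    · exact ⟨i, by rw [center_coe]⟩
  · rintro ⟨i, rfl⟩
    by_cases hi : i = 0
    · subst hi; exact Or.inl (by rw [center_zero])
    · exact Or.inr ⟨⟨i, hi⟩, by rw [← center_coe x ⟨i, hi⟩]⟩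

/-- The positions of the other centres for which the spheres of radii `s` around them and around
the origin meet in a local minimum of the complement of the open balls. -/
def goodConfigs (s : Fin d → ℝ) : Set ({i : Fin d // i ≠ 0} → E d) :=
  {x | ∃ y ∈ downCone d, (∀ i, ‖y i‖ = s i) ∧ ∀ i : {i : Fin d // i ≠ 0}, x i = y i - y 0}

theorem mem_spheresInter_iff {a : Fin d → ℝ≥0} (ha : ∀ i, a i ≠ 0)
    (x : {i : Fin d // i ≠ 0} → E d) (q : E d) :
    q ∈ spheresInter 1 (config a x) ↔ ∀ i, ‖center x i - q‖ = a i := by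
  rw [spheresInter, config_eq_range, Set.biInter_range, Set.mem_iInter]
  refine forall_congr' fun i => ?_
  rw [one_mul, frontier_closedBall _ (NNReal.coe_ne_zero.2 (ha i)), mem_sphere_iff_norm,
    norm_sub_rev]

theorem mem_openBallsCompl_iff {a : Fin d → ℝ≥0} (ha : ∀ i, a i ≠ 0)
    (x : {i : Fin d // i ≠ 0} → E d) (q : E d) :
    q ∈ openBallsCompl 1 (config a x) ↔ ∀ i, a i ≤ ‖center x i - q‖ := by
  rw [openBallsCompl, config_eq_range, Set.biUnion_range, Set.compl_iUnion, Set.mem_iInter]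
  refine forall_congr' fun i => ?_
  rw [one_mul, interior_closedBall _ (NNReal.coe_ne_zero.2 (ha i)), Set.mem_compl_iff,
    mem_ball_iff_norm, not_lt, norm_sub_rev]

/-- Take `y i` to be the centre minus `q`; since centre `0` is the origin, `q = -y 0`. Conversely,
the cone condition yields distinct centres and a second intersection point strictly below `q`, so
the lexicographic tie-break never decides. -/
theorem h_config_of_pos {a : Fin d → ℝ≥0} (ha : ∀ i, a i ≠ 0) (x : {i : Fin d // i ≠ 0} → E d) :
    h 1 (config a x) = (goodConfigs fun i => (a i : ℝ)).indicator 1 x := by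
  have key : ((config a x).encard = d ∧ (spheresInter 1 (config a x)).encard = 2 ∧
      ∃ p ∈ spheresInter 1 (config a x), ∃ q ∈ spheresInter 1 (config a x),
        Before p q ∧ IsLocalMinimum (openBallsCompl 1 (config a x)) q) ↔
      x ∈ goodConfigs fun i => (a i : ℝ) := by
    constructor
    · rintro ⟨-, -, p, -, q, hq, -, -, U, hU, hmin⟩
      rw [mem_spheresInter_iff ha] at hq
      obtain ⟨δ, hδ, hball⟩ := Metric.mem_nhds_iff.1 hU
      refine ⟨fun i => center x i - q, ?_, hq, fun i => ?_⟩
      · refine mem_downCone_of_forall_height_pos hδ fun v hv hv0 hvi => ?_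
        have hlow := hmin (q + v) ⟨(mem_openBallsCompl_iff ha x _).2 fun i => ?_,
          hball (by simpa using hv)⟩ (by simpa using hv0)
        · rw [Lower, ← inner_up, ← inner_up, inner_add_left, inner_up v] at hlow
          linarith
        · rw [← hq i, ← sub_sub]
          exact hvi i
      · simp [center_zero, center_coe]
    · rintro ⟨y, hy, hys, hyx⟩
      have hcy : ∀ i, center x i = y i - y 0 := fun i => by
        by_cases hi : i = 0
        · subst hi; simp [center_zero]
        · rw [← hyx ⟨i, hi⟩, ← center_coe x ⟨i, hi⟩]
      obtain ⟨hl, -⟩ := mem_downCone_iff.1 hy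
      obtain ⟨w, hw0, hwh, hw⟩ := exists_second_intersection hy
      obtain ⟨δ, hδ, hmin⟩ := exists_forall_height_pos_of_mem hy
      have hsub : ∀ i v, center x i - (-y 0 + v) = y i - v := fun i v => by rw [hcy]; abel
      have hS : spheresInter 1 (config a x) = {-y 0 + w, -y 0} := by
        ext q
        obtain ⟨v, rfl⟩ : ∃ v, q = -y 0 + v := ⟨q + y 0, by abel⟩
        rw [mem_spheresInter_iff ha]
        simp only [hsub, ← hys, hw]
        simp [or_comm]
      have hne : -y 0 + w ≠ -y 0 := by simpa using hw0
      refine ⟨?_, ?_, -y 0 + w, by simp [hS], -y 0, by simp [hS], Or.inl ?_, ?_, Metric.ball (-y 0) δ,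
        Metric.ball_mem_nhds _ hδ, ?_⟩
      · have hinj : Function.Injective fun i => (center x i, a i) := by
          intro i j hij
          have := (Prod.ext_iff.1 hij).1
          simp only [hcy, sub_left_inj] at this
          exact hl.injective this
        rw [config_eq_range, ← Set.image_univ, hinj.injOn.encard_image]
        simp
      · rw [hS, Set.encard_pair hne]
      · rw [Lower, ← inner_up, ← inner_up, inner_add_left, inner_up w]
        linarith
      · rw [mem_openBallsCompl_iff ha]
        intro i
        have := hsub i 0
        simp only [add_zero, sub_zero] at this
        rw [this, hys]
      · rintro q ⟨hq, hqU⟩ hqne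
        obtain ⟨v, rfl⟩ : ∃ v, q = -y 0 + v := ⟨q + y 0, by abel⟩
        rw [mem_openBallsCompl_iff ha] at hq
        simp only [hsub, ← hys] at hq
        have := hmin v (by simpa using hqU) (by simpa using hqne) hq
        rw [Lower, ← inner_up (-y 0 + v), inner_add_left, inner_up v, inner_up]
        linarith
  rw [h]
  by_cases hx : x ∈ goodConfigs fun i => (a i : ℝ)
  · rw [if_pos (key.2 hx), Set.indicator_of_mem hx]; rfl
  · rw [if_neg (fun hc => hx (key.1 hc)), Set.indicator_of_notMem hx]

/-- A degenerate ball leaves at most its centre in the intersection, not two points. -/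
theorem h_config_of_exists_eq_zero {a : Fin d → ℝ≥0} (ha : ∃ i, a i = 0)
    (x : {i : Fin d // i ≠ 0} → E d) : h 1 (config a x) = 0 := by
  obtain ⟨i, hi⟩ := ha
  rw [h, if_neg]
  rintro ⟨-, h2, -⟩
  have hsub : spheresInter 1 (config a x) ⊆ {center x i} := by
    intro q hq
    rw [spheresInter, config_eq_range, Set.biInter_range, Set.mem_iInter] at hq
    have := Metric.isClosed_closedBall.frontier_subset (hq i)
    simpa [hi] using this
  have := Set.encard_le_encard hsub
  rw [h2, Set.encard_singleton] at this
  exact absurd this (by norm_num)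


/-! ### Derivatives of the norm and radial projection; determinants of shears and dilations. -/

section Derivatives

variable {V : Type*} [NormedAddCommGroup V] [InnerProductSpace ℝ V]

/-- The derivative of the norm away from the origin. -/
noncomputable def normDeriv (v : V) : V →L[ℝ] ℝ := ‖v‖⁻¹ • innerSL ℝ v

theorem normDeriv_apply (v δ : V) : normDeriv v δ = ‖v‖⁻¹ * inner ℝ v δ := rfl

theorem hasFDerivAt_norm_of_ne_zero {v : V} (hv : v ≠ 0) :
    HasFDerivAt (fun v : V => ‖v‖) (normDeriv v) v := by
  have hn : 0 < ‖v‖ := norm_pos_iff.2 hv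
  have h := (hasStrictFDerivAt_norm_sq v).hasFDerivAt.sqrt (by positivity)
  have e : (fun v : V => √(‖v‖ ^ 2)) = fun v => ‖v‖ := by
    funext v; exact Real.sqrt_sq (norm_nonneg v)
  rw [e] at h
  refine h.congr_fderiv ?_
  rw [Real.sqrt_sq hn.le]
  ext δ
  simp [normDeriv]
  field_simp

/-- The derivative of the radial projection `v ↦ s v / ‖v‖` onto the sphere of radius `s`. -/
noncomputable def projDeriv (s : ℝ) (v : V) : V →L[ℝ] V :=
  (s / ‖v‖) • (ContinuousLinearMap.id ℝ V - (normDeriv v).smulRight (‖v‖⁻¹ • v))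

theorem projDeriv_apply (s : ℝ) (v δ : V) :
    projDeriv s v δ = (s / ‖v‖) • (δ - normDeriv v δ • ‖v‖⁻¹ • v) := rfl

theorem hasFDerivAt_proj (s : ℝ) {v : V} (hv : v ≠ 0) :
    HasFDerivAt (fun v : V => (s / ‖v‖) • v) (projDeriv s v) v := by
  have hn : ‖v‖ ≠ 0 := norm_ne_zero_iff.2 hv
  have h1 : HasFDerivAt (fun v : V => s / ‖v‖) (-(s / ‖v‖ ^ 2) • normDeriv v) v := by
    have := ((hasDerivAt_inv hn).const_mul s).comp_hasFDerivAt v (hasFDerivAt_norm_of_ne_zero hv)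
    refine this.congr_fderiv ?_
    ext δ
    simp
    left
    ring
  refine (h1.smul (hasFDerivAt_id v)).congr_fderiv ?_
  ext δ
  simp only [projDeriv_apply, add_apply, smul_apply,
    ContinuousLinearMap.smulRight_apply, ContinuousLinearMap.id_apply, smul_sub, smul_smul,
    smul_eq_mul, id_eq]
  rw [sub_eq_add_neg, ← neg_smul]
  congr 2
  field_simp

theorem det_id_add_of_comp_self_eq_zero {W : Type*} [AddCommGroup W] [Module ℝ W]
    [FiniteDimensional ℝ W] (g : W →ₗ[ℝ] W) (hg : ∀ w, g (g w) = 0) :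
    LinearMap.det (LinearMap.id + g) = 1 := by
  have hnil : IsNilpotent (-g : Module.End ℝ W) := by
    refine ⟨2, ?_⟩
    ext w
    simp [pow_two, hg]
  have h := LinearMap.eval_charpoly (-g) 1
  rw [hnil.charpoly_eq_X_pow_finrank] at h
  simp only [Polynomial.eval_pow, Polynomial.eval_X, one_pow, map_one, sub_neg_eq_add] at h
  exact h.symm

/-- The operator that dilates the orthogonal complement of `v` by `k` and fixes `v`. -/
noncomputable def orthDilation (k : ℝ) (v : V) : V →ₗ[ℝ] V :=
  k • LinearMap.id + (1 - k) • (normDeriv v).toLinearMap.smulRight (‖v‖⁻¹ • v)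

theorem orthDilation_apply (k : ℝ) (v δ : V) :
    orthDilation k v δ = k • δ + (1 - k) • normDeriv v δ • ‖v‖⁻¹ • v := rfl

theorem normDeriv_self {v : V} (hv : v ≠ 0) : normDeriv v (‖v‖⁻¹ • v) = 1 := by
  have hn : ‖v‖ ≠ 0 := norm_ne_zero_iff.2 hv
  rw [normDeriv_apply, real_inner_smul_right, real_inner_self_eq_norm_sq]
  field_simp

theorem normDeriv_orthDilation (k : ℝ) {v : V} (hv : v ≠ 0) (δ : V) :
    normDeriv v (orthDilation k v δ) = normDeriv v δ := by
  rw [orthDilation_apply, map_add, map_smul, map_smul, map_smul, normDeriv_self hv]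
  simp only [smul_eq_mul]; ring

/-- The operator is `k` times a transvection of determinant `1 / k`. -/
theorem det_orthDilation [FiniteDimensional ℝ V] {k : ℝ} (hk : k ≠ 0) {v : V} (hv : v ≠ 0) :
    LinearMap.det (orthDilation k v) = k ^ (Module.finrank ℝ V - 1) := by
  have h : orthDilation k v =
      k • LinearMap.transvection (normDeriv v).toLinearMap (((1 - k) / k) • ‖v‖⁻¹ • v) := by
    ext δ
    rw [orthDilation_apply, LinearMap.smul_apply, LinearMap.transvection.apply]
    simp only [ContinuousLinearMap.coe_coe, smul_add, smul_smul]
    congr 2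
    field_simp
  have hpos : 0 < Module.finrank ℝ V :=
    have : Nontrivial V := ⟨⟨v, 0, hv⟩⟩
    Module.finrank_pos
  rw [h, LinearMap.det_smul, LinearMap.transvection.det, ContinuousLinearMap.coe_coe, map_smul,
    normDeriv_self hv, smul_eq_mul, mul_one]
  obtain ⟨n, hn⟩ := Nat.exists_eq_succ_of_ne_zero hpos.ne'
  rw [hn, Nat.succ_sub_one, pow_succ]
  field_simp
  ring

end Derivatives

/-! ### The change of variables and its Jacobian. -/

/-- A system of vectors is sent to the system of the differences of their radial projections onto
the spheres of radii `s i`, together with their norms, which are put into the component `0`. -/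
noncomputable def sphereMap (s : Fin d → ℝ) (y : Fin d → E d) : Fin d → E d := fun i =>
  if i = 0 then WithLp.toLp 2 fun j => ‖y j‖ else (s i / ‖y i‖) • y i - (s 0 / ‖y 0‖) • y 0

/-- The derivative of `sphereMap s`. -/
noncomputable def sphereMapDeriv (s : Fin d → ℝ) (y : Fin d → E d) :
    (Fin d → E d) →L[ℝ] (Fin d → E d) :=
  ContinuousLinearMap.pi fun i =>
    if i = 0 then
      (EuclideanSpace.equiv (Fin d) ℝ).symm.toContinuousLinearMap.comp
        (ContinuousLinearMap.pi fun j => (normDeriv (y j)).comp (ContinuousLinearMap.proj j))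
    else (projDeriv (s i) (y i)).comp (ContinuousLinearMap.proj i) -
      (projDeriv (s 0) (y 0)).comp (ContinuousLinearMap.proj 0)

theorem hasFDerivAt_sphereMap (s : Fin d → ℝ) {y : Fin d → E d} (hy : ∀ i, y i ≠ 0) :
    HasFDerivAt (sphereMap s) (sphereMapDeriv s y) y := by
  rw [hasFDerivAt_pi']
  intro i
  by_cases hi : i = 0
  · simp only [sphereMap, sphereMapDeriv, hi, if_true, ContinuousLinearMap.proj_pi]
    refine (EuclideanSpace.equiv (Fin d) ℝ).symm.toContinuousLinearMap.hasFDerivAt.comp y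
      (hasFDerivAt_pi.2 fun j => ?_)
    exact (hasFDerivAt_norm_of_ne_zero (hy j)).comp y (hasFDerivAt_apply j y)
  · simp only [sphereMap, sphereMapDeriv, hi, if_false, ContinuousLinearMap.proj_pi]
    have h : ∀ j, HasFDerivAt (fun y : Fin d → E d => (s j / ‖y j‖) • y j)
        ((projDeriv (s j) (y j)).comp (ContinuousLinearMap.proj j)) y := fun j =>
      (hasFDerivAt_proj (s j) (hy j)).comp (f := fun y : Fin d → E d => y j) y
        (hasFDerivAt_apply j y)
    exact (h i).sub (h 0)

/-- The operator whose coordinates are the derivatives of the norm at the vectors `y j`. -/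
noncomputable def rowOperator {n : ℕ} (y : Fin n → E n) : E n →ₗ[ℝ] E n :=
  Matrix.toLin (EuclideanSpace.basisFun (Fin n) ℝ).toBasis
    (EuclideanSpace.basisFun (Fin n) ℝ).toBasis (Matrix.of fun i j => (‖y i‖⁻¹ • y i) j)

theorem det_rowOperator {n : ℕ} (y : Fin n → E n) :
    LinearMap.det (rowOperator y) = (∏ i, ‖y i‖⁻¹) * rowDet y := by
  rw [rowOperator, LinearMap.det_toLin, ← rowDet_smul, rowDet]

theorem rowOperator_apply {n : ℕ} (y : Fin n → E n) (z : E n) (j : Fin n) :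
    rowOperator y z j = normDeriv (y j) z := by
  rw [rowOperator, Matrix.toLin_apply, normDeriv_apply, ← real_inner_smul_left, PiLp.inner_apply]
  simp [Matrix.mulVec, dotProduct, Pi.single_apply, mul_comm]

/-- The derivative factors into block-diagonal maps and unipotent shears. `P₁` scales tangential
parts and keeps radial ones; `n₁` subtracts component `0` from the others; `P₂` takes radial
derivatives of component `0` along every `y j`; `n₂` corrects these to those of component `j`; `n₃`
removes the radial parts from the differences. Only `P₁` and `P₂` contribute to the determinant. -/
theorem det_sphereMapDeriv {s : Fin d → ℝ} (hs : ∀ i, s i ≠ 0) {y : Fin d → E d}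
    (hy : ∀ i, y i ≠ 0) :
    (sphereMapDeriv s y).det =
      (∏ i, (s i / ‖y i‖) ^ (d - 1)) * ((∏ i, ‖y i‖⁻¹) * rowDet y) := by
  let n₁ : (Fin d → E d) →ₗ[ℝ] (Fin d → E d) :=
    LinearMap.pi fun i => if i = 0 then 0 else -LinearMap.proj 0
  let P₁ : (Fin d → E d) →ₗ[ℝ] (Fin d → E d) :=
    LinearMap.pi fun i => (orthDilation (s i / ‖y i‖) (y i)).comp (LinearMap.proj i)
  let P₂ : (Fin d → E d) →ₗ[ℝ] (Fin d → E d) :=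
    LinearMap.pi fun i => (if i = 0 then rowOperator y else LinearMap.id).comp (LinearMap.proj i)
  let n₂ : (Fin d → E d) →ₗ[ℝ] (Fin d → E d) :=
    LinearMap.pi fun i => if i = 0 then
      (WithLp.linearEquiv 2 ℝ (Fin d → ℝ)).symm.toLinearMap.comp (LinearMap.pi fun j =>
        if j = 0 then 0 else (normDeriv (y j)).toLinearMap.comp (LinearMap.proj j)) else 0
  let coord : Fin d → (Fin d → E d) →ₗ[ℝ] ℝ := fun i =>
    (EuclideanSpace.proj i : E d →L[ℝ] ℝ).toLinearMap.comp (LinearMap.proj 0)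
  let n₃ : (Fin d → E d) →ₗ[ℝ] (Fin d → E d) :=
    LinearMap.pi fun i => if i = 0 then 0 else
      (coord 0).smulRight (‖y 0‖⁻¹ • y 0) - (coord i).smulRight (‖y i‖⁻¹ • y i)
  have h₁ : LinearMap.det (LinearMap.id + n₁) = 1 := by
    refine det_id_add_of_comp_self_eq_zero n₁ fun w => ?_
    funext i
    by_cases hi : i = 0 <;> simp [n₁, hi]
  have h₂ : LinearMap.det (LinearMap.id + n₂) = 1 := by
    refine det_id_add_of_comp_self_eq_zero n₂ fun w => ?_
    funext i
    by_cases hi : i = 0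
    · ext j
      by_cases hj : j = 0 <;> simp [n₂, hi, hj]
    · simp [n₂, hi]
  have h₃ : LinearMap.det (LinearMap.id + n₃) = 1 := by
    refine det_id_add_of_comp_self_eq_zero n₃ fun w => ?_
    funext i
    by_cases hi : i = 0 <;> simp [n₃, coord, hi]
  have hP₁ : LinearMap.det P₁ = ∏ i, (s i / ‖y i‖) ^ (d - 1) := by
    rw [LinearMap.det_pi]
    refine Finset.prod_congr rfl fun i _ => ?_
    rw [det_orthDilation (div_ne_zero (hs i) (norm_ne_zero_iff.2 (hy i))) (hy i),
      finrank_euclideanSpace, Fintype.card_fin]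
  have hP₂ : LinearMap.det P₂ = (∏ i, ‖y i‖⁻¹) * rowDet y := by
    rw [LinearMap.det_pi, ← det_rowOperator, Finset.prod_eq_single 0]
    · simp
    · intro i _ hi
      simp [hi]
    · simp
  have hcomp : (sphereMapDeriv s y).toLinearMap =
      (LinearMap.id + n₃) ∘ₗ (LinearMap.id + n₂) ∘ₗ P₂ ∘ₗ (LinearMap.id + n₁) ∘ₗ P₁ := by
    refine LinearMap.ext fun δ => ?_
    set η : Fin d → E d := P₁ δ with hη
    have hηi : ∀ i, η i = orthDilation (s i / ‖y i‖) (y i) (δ i) := fun i => rfl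
    have hnη : ∀ i, normDeriv (y i) (η i) = normDeriv (y i) (δ i) := fun i => by
      rw [hηi, normDeriv_orthDilation _ (hy i)]
    set ζ : Fin d → E d := P₂ (η + n₁ η) + n₂ (P₂ (η + n₁ η)) with hζ
    have hζ0 : ∀ j, ζ 0 j = normDeriv (y j) (δ j) := by
      intro j
      rw [← hnη]
      by_cases hj : j = 0
      · subst hj
        simp [hζ, n₂, P₂, n₁, rowOperator_apply]
      · simp [hζ, n₂, P₂, n₁, rowOperator_apply, hj]
    have hζi : ∀ i, i ≠ 0 → ζ i = η i - η 0 := by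
      intro i hi
      simp [hζ, n₂, P₂, n₁, hi, sub_eq_add_neg]
    change _ = ζ + n₃ ζ
    funext i
    by_cases hi : i = 0
    · subst hi
      ext j
      simp [sphereMapDeriv, n₃, hζ0]
    · have hL : ∀ i, projDeriv (s i) (y i) (δ i) = η i - normDeriv (y i) (δ i) • ‖y i‖⁻¹ • y i := by
        intro i
        rw [projDeriv_apply, hηi, orthDilation_apply]
        module
      have e1 : (sphereMapDeriv s y).toLinearMap δ i =
          projDeriv (s i) (y i) (δ i) - projDeriv (s 0) (y 0) (δ 0) := by
        simp [sphereMapDeriv, hi]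
      have e2 : n₃ ζ i = ζ 0 0 • ‖y 0‖⁻¹ • y 0 - ζ 0 i • ‖y i‖⁻¹ • y i := by
        simp [n₃, hi, coord]
      rw [e1, Pi.add_apply, e2, hζi i hi, hζ0, hζ0, hL, hL]
      abel
  rw [ContinuousLinearMap.det, hcomp, LinearMap.det_comp, LinearMap.det_comp, LinearMap.det_comp,
    LinearMap.det_comp, h₁, h₂, h₃, hP₁, hP₂]
  ring


/-! ### Injectivity, image and the volume of the good configurations. -/

theorem ne_zero_of_mem_downCone {y : Fin d → E d} (hy : y ∈ downCone d) (i : Fin d) : y i ≠ 0 :=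
  (mem_downCone_iff.1 hy).1.ne_zero i

theorem norm_proj {V : Type*} [NormedAddCommGroup V] [NormedSpace ℝ V] {s : ℝ} (hs : 0 < s) {v : V}
    (hv : v ≠ 0) : ‖(s / ‖v‖) • v‖ = s := by
  have hn : 0 < ‖v‖ := norm_pos_iff.2 hv
  rw [norm_smul, Real.norm_eq_abs, abs_of_pos (by positivity)]
  field_simp

theorem proj_mem_downCone {s : Fin d → ℝ} (hs : ∀ i, 0 < s i) {y : Fin d → E d}
    (hy : y ∈ downCone d) : (fun i => (s i / ‖y i‖) • y i) ∈ downCone d :=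
  smul_mem_downCone
    (fun i => div_pos (hs i) (norm_pos_iff.2 (ne_zero_of_mem_downCone hy i))) hy

/-- Otherwise `w` would be the second intersection point seen from `0` and `-w` the one seen from
`w`, and both would have negative height. -/
theorem eq_zero_of_sub_mem_downCone {y : Fin d → E d} {w : E d} (hy : y ∈ downCone d)
    (hyw : (fun i => y i - w) ∈ downCone d) (h : ∀ i, ‖y i - w‖ = ‖y i‖) : w = 0 := by
  obtain ⟨w₁, -, h₁, hw₁⟩ := exists_second_intersection hy
  obtain ⟨w₂, -, h₂, hw₂⟩ := exists_second_intersection hyw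
  rcases (hw₁ w).1 h with h0 | h0
  · exact h0
  · rcases (hw₂ (-w)).1 (fun i => by rw [sub_neg_eq_add, sub_add_cancel, h]) with h3 | h3
    · exact neg_eq_zero.1 h3
    · rw [← h3, ← inner_up, inner_neg_left, inner_up, h0] at h₂
      linarith

theorem sphereMap_zero (s : Fin d → ℝ) (y : Fin d → E d) (j : Fin d) :
    sphereMap s y 0 j = ‖y j‖ := by
  simp [sphereMap]

theorem sphereMap_of_ne (s : Fin d → ℝ) (y : Fin d → E d) {i : Fin d} (hi : i ≠ 0) :
    sphereMap s y i = (s i / ‖y i‖) • y i - (s 0 / ‖y 0‖) • y 0 := by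
  simp [sphereMap, hi]

/-- Component `0` gives the norms; the other components give the projections up to a common
translation, which `eq_zero_of_sub_mem_downCone` excludes. -/
theorem injOn_sphereMap {s : Fin d → ℝ} (hs : ∀ i, 0 < s i) :
    Set.InjOn (sphereMap s) (downCone d) := by
  intro y hy z hz hyz
  have hnorm : ∀ j, ‖y j‖ = ‖z j‖ := fun j => by
    rw [← sphereMap_zero s, ← sphereMap_zero s, hyz]
  have hy' := proj_mem_downCone hs hy
  have hz' := proj_mem_downCone hs hz
  set y' : Fin d → E d := fun i => (s i / ‖y i‖) • y i with hy'_def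
  set z' : Fin d → E d := fun i => (s i / ‖z i‖) • z i with hz'_def
  have hdiff : z' = fun i => y' i - (y' 0 - z' 0) := by
    funext i
    by_cases hi : i = 0
    · subst hi; abel
    · have h1 : y' i - y' 0 = z' i - z' 0 := by
        have := congrFun hyz i
        rwa [sphereMap_of_ne s y hi, sphereMap_of_ne s z hi] at this
      rw [sub_sub_eq_add_sub, add_sub_right_comm, h1]
      abel
  have hw : y' 0 - z' 0 = 0 := by
    refine eq_zero_of_sub_mem_downCone hy' (hdiff ▸ hz') fun i => ?_
    have : y' i - (y' 0 - z' 0) = z' i := (congrFun hdiff i).symm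
    rw [this, norm_proj (hs i) (ne_zero_of_mem_downCone hz i),
      norm_proj (hs i) (ne_zero_of_mem_downCone hy i)]
  funext i
  have h1 : y' i = z' i := by rw [congrFun hdiff i, hw, sub_zero]
  have h2 : s i / ‖z i‖ ≠ 0 :=
    (div_pos (hs i) (norm_pos_iff.2 (ne_zero_of_mem_downCone hz i))).ne'
  simp only [hy'_def, hz'_def, hnorm i] at h1
  exact smul_right_injective _ h2 h1

theorem image_sphereMap {s : Fin d → ℝ} (hs : ∀ i, 0 < s i) :
    sphereMap s '' downCone d =
      {ζ | (∀ j, 0 < ζ 0 j) ∧ (fun i : {i : Fin d // i ≠ 0} => ζ i) ∈ goodConfigs s} := by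
  ext ζ
  constructor
  · rintro ⟨y, hy, rfl⟩
    refine ⟨fun j => ?_, _, proj_mem_downCone hs hy, fun i =>
      norm_proj (hs i) (ne_zero_of_mem_downCone hy i), fun i => sphereMap_of_ne s y i.2⟩
    rw [sphereMap_zero]
    exact norm_pos_iff.2 (ne_zero_of_mem_downCone hy j)
  · rintro ⟨h0, y, hy, hys, hyx⟩
    have hn : ∀ i, ‖(ζ 0 i / s i) • y i‖ = ζ 0 i := fun i => by
      rw [norm_smul, Real.norm_eq_abs, abs_of_pos (div_pos (h0 i) (hs i)), hys,
        div_mul_cancel₀ _ (hs i).ne']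
    have hp : ∀ i, (s i / ζ 0 i) • (ζ 0 i / s i) • y i = y i := fun i => by
      rw [smul_smul, div_mul_div_comm, mul_comm, div_self (mul_pos (h0 i) (hs i)).ne', one_smul]
    refine ⟨fun i => (ζ 0 i / s i) • y i, smul_mem_downCone (fun i => div_pos (h0 i) (hs i)) hy, ?_⟩
    funext i
    by_cases hi : i = 0
    · subst hi
      ext j
      rw [sphereMap_zero, hn]
    · rw [sphereMap_of_ne _ _ hi, hn, hn, hp, hp]
      exact (hyx ⟨i, hi⟩).symm

/-- The system with the component `v` at the index `0` and the components `x` elsewhere. -/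
def assemble (p : ({i : Fin d // i ≠ 0} → E d) × E d) : Fin d → E d :=
  fun i => if h : i ≠ 0 then p.1 ⟨i, h⟩ else p.2

theorem measurePreserving_assemble :
    MeasurePreserving (assemble : ({i : Fin d // i ≠ 0} → E d) × E d → Fin d → E d) := by
  let u : Unique {i : Fin d // ¬ i ≠ 0} := ⟨⟨⟨0, by simp⟩⟩, fun i => by
    ext1; simpa using i.2⟩
  have h1 := (volume_preserving_piEquivPiSubtypeProd (fun _ : Fin d => E d) (fun i => i ≠ 0)).symm
  have h2 := (volume_preserving_piUnique fun _ : {i : Fin d // ¬ i ≠ 0} => E d).symm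
  have h3 := (MeasurePreserving.id (volume : Measure ({i : Fin d // i ≠ 0} → E d))).prod h2
  exact h1.comp h3

theorem continuousOn_sphereMap (s : Fin d → ℝ) : ContinuousOn (sphereMap s) (downCone d) :=
  fun _ hy => (hasFDerivAt_sphereMap s
    (ne_zero_of_mem_downCone hy)).continuousAt.continuousWithinAt

/-- Lusin–Souslin: an injective continuous image of a Borel set is Borel. -/
theorem measurableSet_image_sphereMap {s : Fin d → ℝ} (hs : ∀ i, 0 < s i) :
    MeasurableSet (sphereMap s '' downCone d) :=
  isOpen_downCone.measurableSet.image_of_continuousOn_injOn (continuousOn_sphereMap s)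
    (injOn_sphereMap hs)

theorem assemble_mem_image_iff {s : Fin d → ℝ} (hs : ∀ i, 0 < s i)
    (p : ({i : Fin d // i ≠ 0} → E d) × E d) :
    assemble p ∈ sphereMap s '' downCone d ↔ (∀ j, 0 < p.2 j) ∧ p.1 ∈ goodConfigs s := by
  rw [image_sphereMap hs]
  have h0 : assemble p 0 = p.2 := by simp [assemble]
  have h1 : (fun i : {i : Fin d // i ≠ 0} => assemble p i) = p.1 := by
    funext i; simp [assemble, i.2]
  rw [Set.mem_ofPred_eq, h0, h1]

theorem measurableSet_goodConfigs {s : Fin d → ℝ} (hs : ∀ i, 0 < s i) :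
    MeasurableSet (goodConfigs s) := by
  -- The good configurations are the slice of the image where all norms are `1`.
  have h : goodConfigs s = (fun x => assemble (x, WithLp.toLp 2 fun _ => 1)) ⁻¹'
      (sphereMap s '' downCone d) := by
    ext x
    rw [Set.mem_preimage, assemble_mem_image_iff hs]
    simp
  rw [h]
  exact (measurePreserving_assemble.measurable.comp
    (measurable_id.prodMk measurable_const)) (measurableSet_image_sphereMap hs)

/-- The radial weight `r ^ n exp (-r² / 2)` on the positive half-line. -/
noncomputable def radialWeight (n : ℕ) : ℝ → ℝ := (Set.Ioi 0).indicator fun r => r ^ n * gauss r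

theorem radialWeight_nonneg (n : ℕ) (r : ℝ) : 0 ≤ radialWeight n r :=
  Set.indicator_nonneg (f := fun r : ℝ => r ^ n * gauss r)
    (fun x hx => mul_nonneg (pow_nonneg (le_of_lt hx) _) (gauss_pos x).le) r

theorem measurable_radialWeight (n : ℕ) : Measurable (radialWeight n) :=
  ((measurable_id.pow_const n).mul continuous_gauss.measurable).indicator measurableSet_Ioi

theorem lintegral_radialWeight (m n : ℕ) :
    ∫⁻ v : E m, ENNReal.ofReal (∏ j, radialWeight n (v j)) =
      ENNReal.ofReal (halfMoment n ^ m) := by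
  have hm : Measurable fun v : E m => ENNReal.ofReal (∏ j, radialWeight n (v j)) :=
    (Finset.measurable_prod _ fun j _ =>
      (measurable_radialWeight n).comp (by fun_prop)).ennreal_ofReal
  rw [← (PiLp.volume_preserving_toLp (Fin m)).lintegral_comp hm]
  have h := lintegral_prod_eq_pow (X := ℝ) (f := radialWeight n)
    ((integrable_indicator_iff measurableSet_Ioi).2 (integrableOn_halfMoment n))
    (radialWeight_nonneg n) m
  refine h.trans ?_
  rw [radialWeight, integral_indicator measurableSet_Ioi, halfMoment]

/-- A weight depending only on the norms is integrated over the image in two ways: as a product, and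
through the change of variables. The power `r ^ d` in the weight cancels the factors `‖y i‖ ^ (-d)`
of the Jacobian. -/
theorem volume_goodConfigs_mul {s : Fin d → ℝ} (hs : ∀ i, 0 < s i) :
    volume (goodConfigs s) * ENNReal.ofReal (halfMoment d ^ d) =
      ENNReal.ofReal (∏ i, s i ^ (d - 1)) *
        ∫⁻ y in downCone d, ENNReal.ofReal (|rowDet y| * ∏ i, gauss (y i)) := by
  set g : E d → ENNReal := fun v => ENNReal.ofReal (∏ j, radialWeight d (v j)) with hg
  have hgm : Measurable g := (Finset.measurable_prod _ fun j _ =>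
      (measurable_radialWeight d).comp (by fun_prop)).ennreal_ofReal
  have hcov := lintegral_image_eq_lintegral_abs_det_fderiv_mul volume
    isOpen_downCone.measurableSet
    (fun y hy => (hasFDerivAt_sphereMap s (ne_zero_of_mem_downCone hy)).hasFDerivWithinAt)
    (injOn_sphereMap hs) (fun ζ => g (ζ 0))
  have hA := measurableSet_goodConfigs hs
  have hlhs : ∫⁻ ζ in sphereMap s '' downCone d, g (ζ 0) =
      volume (goodConfigs s) * ENNReal.ofReal (halfMoment d ^ d) := by
    rw [← lintegral_indicator (measurableSet_image_sphereMap hs),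
      ← measurePreserving_assemble.lintegral_comp (f := (sphereMap s '' downCone d).indicator
        fun ζ => g (ζ 0)) ((hgm.comp (measurable_pi_apply 0)).indicator
        (measurableSet_image_sphereMap hs))]
    have e : ∀ p : ({i : Fin d // i ≠ 0} → E d) × E d,
        (sphereMap s '' downCone d).indicator (fun ζ => g (ζ 0)) (assemble p) =
          (goodConfigs s).indicator 1 p.1 * g p.2 := by
      intro p
      have h0 : assemble p 0 = p.2 := by simp [assemble]
      by_cases hp : ∀ j, 0 < p.2 j
      · by_cases hp1 : p.1 ∈ goodConfigs s
        · rw [Set.indicator_of_mem ((assemble_mem_image_iff hs p).2 ⟨hp, hp1⟩),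
            Set.indicator_of_mem hp1, h0]
          simp
        · rw [Set.indicator_of_notMem fun h => hp1 ((assemble_mem_image_iff hs p).1 h).2,
            Set.indicator_of_notMem hp1, zero_mul]
      · rw [Set.indicator_of_notMem fun h => hp ((assemble_mem_image_iff hs p).1 h).1]
        push Not at hp
        obtain ⟨j, hj⟩ := hp
        have : g p.2 = 0 := by
          simp only [hg]
          rw [Finset.prod_eq_zero (Finset.mem_univ j), ENNReal.ofReal_zero]
          exact Set.indicator_of_notMem (by simpa using hj) _
        rw [this, mul_zero]
    simp only [e]
    rw [Measure.volume_eq_prod, lintegral_prod_mul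
      (measurable_one.indicator hA).aemeasurable hgm.aemeasurable, lintegral_indicator_one hA,
      lintegral_radialWeight]
  rw [← hlhs, hcov, ← lintegral_const_mul' _ _ ENNReal.ofReal_ne_top]
  refine setLIntegral_congr_fun isOpen_downCone.measurableSet fun y hy => ?_
  have hy0 := ne_zero_of_mem_downCone hy
  have hyn : ∀ i, 0 < ‖y i‖ := fun i => norm_pos_iff.2 (hy0 i)
  have hgy : g (sphereMap s y 0) = ENNReal.ofReal (∏ j, (‖y j‖ ^ d * gauss (y j))) := by
    simp only [hg, sphereMap_zero]
    congr 1
    refine Finset.prod_congr rfl fun j _ => ?_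
    rw [radialWeight, Set.indicator_of_mem (Set.mem_Ioi.2 (hyn j))]
    simp [gauss]
  rw [hgy, det_sphereMapDeriv (fun i => (hs i).ne') hy0, ← ENNReal.ofReal_mul (abs_nonneg _),
    ← ENNReal.ofReal_mul (Finset.prod_nonneg fun i _ => pow_nonneg (hs i).le _)]
  congr 1
  rw [abs_mul, abs_mul, abs_of_nonneg (Finset.prod_nonneg fun i _ =>
      pow_nonneg (div_nonneg (hs i).le (norm_nonneg _)) _),
    abs_of_nonneg (Finset.prod_nonneg fun i _ => inv_nonneg.2 (norm_nonneg _))]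
  have hfac : ∏ i, s i ^ (d - 1) =
      (∏ i, (s i / ‖y i‖) ^ (d - 1)) * (∏ i, ‖y i‖⁻¹) * ∏ i, ‖y i‖ ^ d := by
    rw [← Finset.prod_mul_distrib, ← Finset.prod_mul_distrib]
    refine Finset.prod_congr rfl fun i _ => ?_
    have := (hyn i).ne'
    have hd : ‖y i‖ ^ d = ‖y i‖ ^ (d - 1) * ‖y i‖ := by
      rw [← pow_succ, Nat.sub_add_cancel (NeZero.one_le)]
    rw [hd, div_pow]
    field_simp
  rw [hfac, Finset.prod_mul_distrib]
  ring

theorem volume_goodConfigs {s : Fin d → ℝ} (hs : ∀ i, 0 < s i) :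
    volume (goodConfigs s) = ENNReal.ofReal (Real.pi ^ (((d : ℝ) ^ 2 - 1) / 2) /
      Real.Gamma ((1 + (d : ℝ)) / 2) ^ (d - 1) * ∏ i, s i ^ (d - 1)) := by
  have hH : 0 < halfMoment d ^ d := pow_pos (halfMoment_pos d) d
  have hΓ : 0 < Real.Gamma (((d : ℝ) + 1) / 2) := Real.Gamma_pos_of_pos (by positivity)
  have hS : 0 ≤ ∏ i, s i ^ (d - 1) := Finset.prod_nonneg fun i _ => pow_nonneg (hs i).le _
  have h := volume_goodConfigs_mul hs
  have hD := detMoment_eq_downCone (d := d)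
  rw [detMoment_eq] at hD
  have h2 : (2 : ENNReal) ^ d = ENNReal.ofReal (2 ^ d) := by
    rw [ENNReal.ofReal_pow (by norm_num)]; norm_num
  have key : volume (goodConfigs s) * ENNReal.ofReal (2 ^ d * halfMoment d ^ d) =
      ENNReal.ofReal (∏ i, s i ^ (d - 1)) * ENNReal.ofReal ((2 * Real.pi) ^ ((d : ℝ) ^ 2 / 2) *
        2 ^ ((d : ℝ) / 2) * Real.Gamma (((d : ℝ) + 1) / 2) / √Real.pi) := by
    rw [hD, ENNReal.ofReal_mul (by positivity), ← h2]
    calc _ = 2 ^ d * (volume (goodConfigs s) * ENNReal.ofReal (halfMoment d ^ d)) := by ring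
      _ = _ := by rw [h]; ring
  have hpos : 0 < 2 ^ d * halfMoment d ^ d := by positivity
  rw [← ENNReal.mul_left_inj (c := ENNReal.ofReal (2 ^ d * halfMoment d ^ d))
    (by simpa using hpos) ENNReal.ofReal_ne_top, key, add_comm 1 (d : ℝ),
    ← ENNReal.ofReal_mul hS, ← ENNReal.ofReal_mul (by positivity)]
  congr 1
  rw [halfMoment_eq, mul_pow, ← Real.rpow_natCast (2 ^ _) d, ← Real.rpow_mul (by norm_num),
    Real.mul_rpow (by norm_num) Real.pi_pos.le, Real.sqrt_eq_rpow]
  -- One of the `d` Gamma factors from the radial moments cancels the one in `detMoment`, leaving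
  -- the exponent `d - 1`.
  have hΓd : Real.Gamma (((d : ℝ) + 1) / 2) ^ d =
      Real.Gamma (((d : ℝ) + 1) / 2) ^ (d - 1) * Real.Gamma (((d : ℝ) + 1) / 2) := by
    rw [← pow_succ, Nat.sub_add_cancel NeZero.one_le]
  have e2 : (2 : ℝ) ^ ((d : ℝ) ^ 2 / 2) * 2 ^ ((d : ℝ) / 2) =
      2 ^ d * 2 ^ (((d : ℝ) - 1) / 2 * d) := by
    rw [← Real.rpow_natCast 2 d, ← Real.rpow_add (by norm_num), ← Real.rpow_add (by norm_num)]
    congr 1; ring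
  have eπ : Real.pi ^ ((d : ℝ) ^ 2 / 2) = Real.pi ^ (((d : ℝ) ^ 2 - 1) / 2) *
      Real.pi ^ (1 / 2 : ℝ) := by
    rw [← Real.rpow_add Real.pi_pos]
    congr 1; ring
  rw [hΓd, eπ]
  have hπ : Real.pi ^ (1 / 2 : ℝ) ≠ 0 := by positivity
  calc _ = (∏ i, s i ^ (d - 1)) * ((2 : ℝ) ^ ((d : ℝ) ^ 2 / 2) * 2 ^ ((d : ℝ) / 2)) *
        Real.pi ^ (((d : ℝ) ^ 2 - 1) / 2) * Real.Gamma (((d : ℝ) + 1) / 2) := by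
        field_simp
    _ = _ := by rw [e2]; field_simp


/-! ### The formulas for `G`, `c₀` and the Hall–Janson constant. -/

theorem integrable_h_and_integral (hd : 2 ≤ d) (s : Fin d → ℝ≥0) :
    Integrable (fun x : {i : Fin d // i ≠ 0} → E d => h 1 (config s x)) ∧
      ∫ x : {i : Fin d // i ≠ 0} → E d, h 1 (config s x) =
        Real.pi ^ (((d : ℝ) ^ 2 - 1) / 2) / Real.Gamma ((1 + (d : ℝ)) / 2) ^ (d - 1) *
          ∏ i, (s i : ℝ) ^ (d - 1) := by
  by_cases hs : ∃ i, s i = 0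
  · simp only [h_config_of_exists_eq_zero hs]
    obtain ⟨i, hi⟩ := hs
    refine ⟨integrable_zero _ _ _, ?_⟩
    -- With a zero radius the right side vanishes because `d - 1 ≠ 0`; for `d = 1` it would not.
    rw [Finset.prod_eq_zero (Finset.mem_univ i) (by rw [hi, NNReal.coe_zero, zero_pow (by omega)])]
    simp
  · push Not at hs
    have hpos : ∀ i, 0 < (s i : ℝ) := fun i => NNReal.coe_pos.2 (pos_iff_ne_zero.2 (hs i))
    have hm := measurableSet_goodConfigs hpos
    have hv := volume_goodConfigs hpos
    have hΓ : 0 < Real.Gamma ((1 + (d : ℝ)) / 2) := Real.Gamma_pos_of_pos (by positivity)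
    simp only [h_config_of_pos hs]
    refine ⟨(integrable_indicator_iff hm).2 ?_, ?_⟩
    · exact integrableOn_const (by rw [hv]; exact ENNReal.ofReal_ne_top)
    · rw [integral_indicator_one hm, Measure.real, hv, ENNReal.toReal_ofReal (by positivity)]

theorem G_eq (hd : 2 ≤ d) (s : Fin d → ℝ≥0) :
    G s = Real.pi ^ (((d : ℝ) ^ 2 - 1) / 2) /
      ((d ! : ℝ) * Real.Gamma ((1 + (d : ℝ)) / 2) ^ (d - 1)) * ∏ i, (s i : ℝ) ^ (d - 1) := by
  rw [G, (integrable_h_and_integral hd s).2, ← mul_assoc, one_div_mul_eq_div, div_div,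
    mul_comm (Real.Gamma _ ^ _)]

theorem theta_eq (d : ℕ) [NeZero d] : θ d = √Real.pi ^ d / Real.Gamma (1 + (d : ℝ) / 2) := by
  have hΓ : 0 < Real.Gamma ((d : ℝ) / 2 + 1) := Real.Gamma_pos_of_pos (by positivity)
  have : Nonempty (Fin d) := ⟨0⟩
  rw [θ, EuclideanSpace.volume_closedBall, ENNReal.ofReal_one, one_pow, one_mul,
    Fintype.card_fin, ENNReal.toReal_ofReal (by positivity), add_comm 1]

theorem theta_pos (d : ℕ) [NeZero d] : 0 < θ d := by
  have hΓ : 0 < Real.Gamma (1 + (d : ℝ) / 2) := Real.Gamma_pos_of_pos (by positivity)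
  rw [theta_eq]
  positivity

theorem theta_pow_mul (d : ℕ) [NeZero d] :
    θ d ^ (d - 1) *
      (√Real.pi * Real.Gamma (1 + (d : ℝ) / 2) / Real.Gamma ((1 + (d : ℝ)) / 2)) ^ (d - 1) =
    Real.pi ^ (((d : ℝ) ^ 2 - 1) / 2) / Real.Gamma ((1 + (d : ℝ)) / 2) ^ (d - 1) := by
  have hΓ : Real.Gamma (1 + (d : ℝ) / 2) ≠ 0 := (Real.Gamma_pos_of_pos (by positivity)).ne'
  have hΓ' : Real.Gamma ((1 + (d : ℝ)) / 2) ≠ 0 := (Real.Gamma_pos_of_pos (by positivity)).ne'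
  have h1 : θ d * (√Real.pi * Real.Gamma (1 + (d : ℝ) / 2) / Real.Gamma ((1 + (d : ℝ)) / 2)) =
      √Real.pi ^ (d + 1) / Real.Gamma ((1 + (d : ℝ)) / 2) := by
    rw [theta_eq]
    field_simp
    ring
  rw [← mul_pow, h1, div_pow, ← pow_mul, Real.sqrt_eq_rpow, ← Real.rpow_natCast,
    ← Real.rpow_mul Real.pi_pos.le]
  congr 2
  rw [Nat.cast_mul, Nat.cast_sub NeZero.one_le]
  push_cast
  ring

section Moments

variable {Ω : Type*} [MeasurableSpace Ω] {P : Measure Ω} {Q : Measure ℝ≥0} {Y : Ω → ℝ≥0}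

theorem integrable_G (hd : 2 ≤ d) [SigmaFinite Q] (hY : HasLaw Y Q P)
    (hint : Integrable (fun ω => (Y ω : ℝ) ^ (d - 1)) P) :
    Integrable (G (d := d)) (Measure.pi fun _ => Q) := by
  have hQ : Integrable (fun a : ℝ≥0 => (a : ℝ) ^ (d - 1)) Q := by
    rw [← hY.map_eq]
    exact (integrable_map_measure (by fun_prop) hY.aemeasurable).2 hint
  rw [show G (d := d) = _ from funext (G_eq hd)]
  exact (Integrable.fintype_prod (f := fun _ (a : ℝ≥0) => (a : ℝ) ^ (d - 1))
    (fun _ => hQ)).const_mul _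

/-- The product formula for integrals holds for the Bochner integral even when the moment diverges:
both sides then take the default value `0`. -/
theorem c₀_eq (hd : 2 ≤ d) [SigmaFinite Q] (hY : HasLaw Y Q P) :
    c₀ d Q = moment P Y (d - 1) ^ d * Real.pi ^ (((d : ℝ) ^ 2 - 1) / 2) /
      ((d ! : ℝ) * Real.Gamma ((1 + (d : ℝ)) / 2) ^ (d - 1)) := by
  have hQ : ∫ a : ℝ≥0, (a : ℝ) ^ (d - 1) ∂Q = moment P Y (d - 1) := by
    rw [← hY.map_eq, integral_map hY.aemeasurable (by fun_prop), moment]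
  rw [c₀]
  simp only [G_eq hd]
  rw [integral_const_mul, integral_fintype_prod_eq_pow (fun a : ℝ≥0 => (a : ℝ) ^ (d - 1)), hQ,
    Fintype.card_fin]
  ring

theorem c₀_eq_theta (hd : 2 ≤ d) [SigmaFinite Q] (hY : HasLaw Y Q P) :
    c₀ d Q = moment P Y (d - 1) ^ d * θ d ^ (d - 1) / (d ! : ℝ) *
      (√Real.pi * Real.Gamma (1 + (d : ℝ) / 2) / Real.Gamma ((1 + (d : ℝ)) / 2)) ^ (d - 1) := by
  rw [c₀_eq hd hY, div_mul_eq_mul_div, mul_assoc, theta_pow_mul, mul_div_assoc, mul_div_assoc,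
    div_div, mul_comm (d ! : ℝ)]

theorem c₀_mul_alpha_zpow (hd : 2 ≤ d) [SigmaFinite Q] (hY : HasLaw Y Q P)
    (hM : 0 < moment P Y d) (k : ℕ) :
    c₀ d Q * α d P Y ^ (1 - (d : ℤ)) / ((k - 1)! : ℝ) = hallJanson d k P Y := by
  have hz : (1 - (d : ℤ)) = -((d - 1 : ℕ) : ℤ) := by omega
  have hθ := (theta_pos d).ne'
  have hM' := hM.ne'
  rw [c₀_eq_theta hd hY, α, hallJanson, hz, zpow_neg, zpow_natCast, mul_pow, add_comm (d : ℝ) 1]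
  field_simp

end Moments

end BooleanCoverage

theorem lemma3p2 (d : ℕ) [NeZero d] (hd : 2 ≤ d)
    (Q : Measure ℝ≥0) [IsProbabilityMeasure Q]
    {Ω : Type*} [MeasurableSpace Ω] (P : Measure Ω) [IsProbabilityMeasure P]
    (Y : Ω → ℝ≥0) (hY : HasLaw Y Q P) :
    (∀ s : Fin d → ℝ≥0,
      Integrable (fun x : {i : Fin d // i ≠ 0} → BooleanCoverage.E d =>
        BooleanCoverage.h 1 (BooleanCoverage.config s x)) ∧
      BooleanCoverage.G s =
        Real.pi ^ (((d : ℝ) ^ 2 - 1) / 2) /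
            ((d ! : ℝ) * Real.Gamma ((1 + (d : ℝ)) / 2) ^ (d - 1)) *
          ∏ i, (s i : ℝ) ^ (d - 1)) ∧
    (Integrable (fun ω => (Y ω : ℝ) ^ (d - 1)) P →
      Integrable (BooleanCoverage.G (d := d)) (Measure.pi fun _ => Q) ∧
      BooleanCoverage.c₀ d Q =
        BooleanCoverage.moment P Y (d - 1) ^ d * BooleanCoverage.θ d ^ (d - 1) / (d ! : ℝ) *
          (√Real.pi * Real.Gamma (1 + (d : ℝ) / 2) / Real.Gamma ((1 + (d : ℝ)) / 2)) ^ (d - 1) ∧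
      BooleanCoverage.c₀ d Q =
        BooleanCoverage.moment P Y (d - 1) ^ d * Real.pi ^ (((d : ℝ) ^ 2 - 1) / 2) /
          ((d ! : ℝ) * Real.Gamma ((1 + (d : ℝ)) / 2) ^ (d - 1))) ∧
    (Integrable (fun ω => (Y ω : ℝ) ^ d) P → 0 < BooleanCoverage.moment P Y d →
      ∀ k : ℕ, 1 ≤ k →
        BooleanCoverage.c₀ d Q * BooleanCoverage.α d P Y ^ (1 - (d : ℤ)) / ((k - 1)! : ℝ) =
          BooleanCoverage.hallJanson d k P Y) := by

  refine ⟨fun s => ⟨(BooleanCoverage.integrable_h_and_integral hd s).1,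
      BooleanCoverage.G_eq hd s⟩,
    fun hint => ⟨BooleanCoverage.integrable_G hd hY hint, BooleanCoverage.c₀_eq_theta hd hY,
      BooleanCoverage.c₀_eq hd hY⟩,
    fun _ hM k _ => BooleanCoverage.c₀_mul_alpha_zpow hd hY hM k⟩
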